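/- Let $\mathcal X\subset\mathbb R^{n_x}$ and $\mathcal Y\subset\mathbb R^{n_y}$ be compact convex sets and let $\mathcal L:\mathbb R^{n_x}\times\mathbb R^{n_y}\to\mathbb R$ be continuously differentiable on an open set containing $\mathcal X\times\mathcal Y$. Let $\mu\ge 0$, $L_{xx},L_{yy}\ge 0$, $L_{yx}>0$ be such that for every $x\in\mathcal X$ the function $\mathcal L(x,\cdot)$ is $\mu$-strongly concave on $\mathcal Y$ (merely concave if $\mu=0$), and for all $(x,y),(x',y')\in\mathcal X\times\mathcal Y$ $$\|\nabla_x\mathcal L(x,y)-\nabla_x\mathcal L(x',y')\|\le L_{xx}\|x-x'\|+L_{yx}\|y-y'\|,\qquad \|\nabla_y\mathcal L(x,y)-\nabla_y\mathcal L(x',y')\|\le L_{yx}\|x-x'\|+L_{yy}\|y-y'\|.$$ Given stepsizes $\tau_t>0$ and smoothing parameters $\beta_t\ge 0$, the PO-LMO algorithm starts from $x_0\in\mathcal X$, $y_0\in\mathcal Y$ and iterates, for $t\ge 0$, $$x_{t+1}=\mathrm{PO}_{\mathcal X}\big(x_t-\tau_t\nabla_x\mathcal L(x_t,y_t)\big),\qquad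 u_t\in\operatorname*{arg\,max}_{u\in\mathcal Y}\nabla_y\mathcal L_{\beta_t}(x_t,y_t)^\top u,$$ $$\gamma_t=\min\Big\{\tfrac{\nabla_y\mathcal L_{\beta_t}(x_t,y_t)^\top(u_t-y_t)}{(L_{yy}+\beta_t)\|u_t-y_t\|^2},1\Big\},\qquad y_{t+1}=y_t+\gamma_t(u_t-y_t),$$ where $\mathrm{PO}_{\mathcal X}$ is the Euclidean projection onto $\mathcal X$ and $\mathcal L_\beta(x,y)=\mathcal L(x,y)-\frac\beta2\|y-y_0\|^2$ (if $u_t=y_t$, then $y_{t+1}=y_t$). Put $\sigma=\tau_0$ and $$G^{\mathrm{PO}}_{\mathcal X}(x,y)=\Big\|\tfrac1\sigma\big(\mathrm{PO}_{\mathcal X}(x-\sigma\nabla_x\mathcal L(x,y))-x\big)\Big\|,\qquad G_{\mathcal Y}(x,y)=\max_{u\in\mathcal Y}\mathcal L(x,u)-\mathcal L(x,y),$$ $$\overline G^{\mathrm{PO}}_{\mathcal X}(T)=\tfrac1{T+1}\sum_{t=0}^T G^{\mathrm{PO}}_{\mathcal X}(x_t,y_t),\qquad \overline G_{\mathcal Y}(T)=\tfrac1{T+1}\sum_{t=0}^T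 G_{\mathcal Y}(x_t,y_t).$$ Call $\mathcal Y$ $\alpha$-strongly convex if $\xi y+(1-\xi)y'+\xi(1-\xi)\frac\alpha2\|y-y'\|^2z\in\mathcal Y$ for all $y,y'\in\mathcal Y$, $\|z\|=1$, $\xi\in[0,1]$. Then the following bounds hold for all $T\ge 1$. The implied constants (and, for $\widetilde O$, the power of $\log(T+1)$) depend on the problem and on the sequences $(\tau_t),(\beta_t)$, but not on $T$, the initial points or the choices of $u_t$. (i) If $\tau_t=\Theta(t^{-2/3})$, and $(\beta_t)$ is nonincreasing with $\beta_t=\Theta(t^{-1/6})$, then $\overline G^{\mathrm{PO}}_{\mathcal X}(T)\le\widetilde O(T^{-1/6})$ and $\overline G_{\mathcal Y}(T)\le\widetilde O(T^{-1/6})$. (ii) If $\mu>0$, $\tau_t=\Theta(t^{-1/2})$ and $\beta_t=0$ for all $t$, then $\overline G^{\mathrm{PO}}_{\mathcal X}(T)\le O(T^{-1/4})$ and $\overline G_{\mathcal Y}(T)\le\widetilde O(T^{-1/2})$. (iii) If $\mathcal Y$ is $\alpha$-strongly convex for some $\alpha>0$, $\tau_t=\Theta(t^{-3/5})$, and $(\beta_t)$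 is nonincreasing with $\beta_t=\Theta(t^{-1/5})$, then $\overline G^{\mathrm{PO}}_{\mathcal X}(T)\le O(T^{-1/5})$ and $\overline G_{\mathcal Y}(T)\le O(T^{-1/5})$. (iv) If $\mathcal Y$ is $\alpha$-strongly convex for some $\alpha>0$, $\mu>0$, $\tau_t=\Theta(t^{-1/3})$ and $\beta_t=0$ for all $t$, then $\overline G^{\mathrm{PO}}_{\mathcal X}(T)\le O(T^{-1/3})$ and $\overline G_{\mathcal Y}(T)\le\widetilde O(T^{-2/3})$. -/

import Mathlib

open Asymptotics Filter
open scoped Gradient RealInnerProductSpace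

noncomputable section

namespace POLMO

/-- The Euclidean space `ℝⁿ`. -/
abbrev Euc (n : ℕ) : Type := EuclideanSpace ℝ (Fin n)

/-- The partial gradient `∇ₓ L(x, y)`. -/
def gradX {nx ny : ℕ} (L : Euc nx → Euc ny → ℝ) (x : Euc nx) (y : Euc ny) : Euc nx :=
  gradient (fun x' => L x' y) x

/-- The partial gradient `∇_y L(x, y)`. -/
def gradY {nx ny : ℕ} (L : Euc nx → Euc ny → ℝ) (x : Euc nx) (y : Euc ny) : Euc ny :=
  gradient (fun y' => L x y') y

/-- The regularized payoff `L_β(x, y) = L(x, y) - (β/2) ‖y - y₀‖²`. -/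
def regPayoff {nx ny : ℕ} (L : Euc nx → Euc ny → ℝ) (y₀ : Euc ny) (β : ℝ) :
    Euc nx → Euc ny → ℝ :=
  fun x y => L x y - β / 2 * ‖y - y₀‖ ^ 2

/-- The standing assumptions on the problem `min_{x ∈ X} max_{y ∈ Y} L(x, y)`. -/
structure StandingAssumption {nx ny : ℕ} (X : Set (Euc nx)) (Y : Set (Euc ny))
    (L : Euc nx → Euc ny → ℝ) (μ Lxx Lyx Lyy : ℝ) : Prop where
  compactX : IsCompact X
  convexX : Convex ℝ X
  compactY : IsCompact Y
  convexY : Convex ℝ Y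
  mu_nonneg : 0 ≤ μ
  concave : ∀ x ∈ X, StrongConcaveOn Y μ (L x)
  differentiable : ∃ U : Set (Euc nx × Euc ny), IsOpen U ∧ X ×ˢ Y ⊆ U ∧
    ContDiffOn ℝ 1 (fun p : Euc nx × Euc ny => L p.1 p.2) U
  Lxx_nonneg : 0 ≤ Lxx
  Lyy_nonneg : 0 ≤ Lyy
  Lyx_pos : 0 < Lyx
  lipschitzX : ∀ x ∈ X, ∀ y ∈ Y, ∀ x' ∈ X, ∀ y' ∈ Y,
    ‖gradX L x y - gradX L x' y'‖ ≤ Lxx * ‖x - x'‖ + Lyx * ‖y - y'‖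
  lipschitzY : ∀ x ∈ X, ∀ y ∈ Y, ∀ x' ∈ X, ∀ y' ∈ Y,
    ‖gradY L x y - gradY L x' y'‖ ≤ Lyx * ‖x - x'‖ + Lyy * ‖y - y'‖

/-- `Y` is an `α`-strongly convex set. -/
def IsStronglyConvexSet {n : ℕ} (α : ℝ) (Y : Set (Euc n)) : Prop :=
  ∀ y ∈ Y, ∀ y' ∈ Y, ∀ z : Euc n, ‖z‖ = 1 → ∀ ξ ∈ Set.Icc (0 : ℝ) 1,
    ξ • y + (1 - ξ) • y' + (ξ * (1 - ξ) * (α / 2) * ‖y - y'‖ ^ 2) • z ∈ Y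

/-- `v` is an output of the linear minimization oracle: `v ∈ argmin_{w ∈ C} dᵀ w`. -/
def IsLMO {n : ℕ} (C : Set (Euc n)) (d v : Euc n) : Prop :=
  v ∈ C ∧ ∀ w ∈ C, ⟪d, v⟫ ≤ ⟪d, w⟫

/-- `p` is a minimizer of `v ↦ ‖u - v‖²` over `C`. -/
def IsProjection {n : ℕ} (C : Set (Euc n)) (u p : Euc n) : Prop :=
  p ∈ C ∧ ∀ v ∈ C, ‖u - p‖ ^ 2 ≤ ‖u - v‖ ^ 2

/-- The projection oracle `PO_C(u) = argmin_{v ∈ C} ‖u - v‖²`. -/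
def PO {n : ℕ} (C : Set (Euc n)) (u : Euc n) : Euc n :=
  Classical.epsilon (IsProjection C u)

/-- On a nonempty compact set the projection oracle returns a minimizer. -/
theorem PO_spec {n : ℕ} {C : Set (Euc n)} (hC : IsCompact C) (hne : C.Nonempty) (u : Euc n) :
    IsProjection C u (PO C u) := by
  refine Classical.epsilon_spec (p := IsProjection C u) ?_
  obtain ⟨p, hp, hmin⟩ := hC.exists_isMinOn (f := fun v => ‖u - v‖ ^ 2) hne
    (by fun_prop)
  exact ⟨p, hp, fun v hv => hmin hv⟩

/-- The dual gap `G_Y(x, y) = max_{u ∈ Y} L(x, u) - L(x, y)`. -/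
def dualGap {nx ny : ℕ} (Y : Set (Euc ny)) (L : Euc nx → Euc ny → ℝ)
    (x : Euc nx) (y : Euc ny) : ℝ :=
  sSup ((fun u => L x u) '' Y) - L x y

/-- The projected-gradient-mapping gap
`G_X^PO(x, y) = ‖(1/σ) (PO_X(x - σ ∇ₓ L(x, y)) - x)‖`. -/
def projGap {nx ny : ℕ} (X : Set (Euc nx)) (L : Euc nx → Euc ny → ℝ) (σ : ℝ)
    (x : Euc nx) (y : Euc ny) : ℝ :=
  ‖(1 / σ) • (PO X (x - σ • gradX L x y) - x)‖

/-- `(x_t, y_t)_{t ≥ 0}` is generated by the `PO-LMO` algorithm with primal stepsizes `τ` and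
smoothing parameters `β`; `u` is the sequence of answers of the linear minimization oracle.
The reference point of the regularization is the initial point `y 0`. When `u t = y t` the value
of the dual stepsize is immaterial. -/
def IsPOLMOSequence {nx ny : ℕ} (X : Set (Euc nx)) (Y : Set (Euc ny))
    (L : Euc nx → Euc ny → ℝ) (Lyy : ℝ) (τ β : ℕ → ℝ)
    (x : ℕ → Euc nx) (y : ℕ → Euc ny) : Prop :=
  x 0 ∈ X ∧ y 0 ∈ Y ∧ ∃ u : ℕ → Euc ny, ∀ t : ℕ,
    x (t + 1) = PO X (x t - τ t • gradX L (x t) (y t)) ∧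
    IsLMO Y (-gradY (regPayoff L (y 0) (β t)) (x t) (y t)) (u t) ∧
    y (t + 1) = y t +
      (min (⟪gradY (regPayoff L (y 0) (β t)) (x t) (y t), u t - y t⟫ /
        ((Lyy + β t) * ‖u t - y t‖ ^ 2)) 1) • (u t - y t)

/-- Positive primal stepsizes with `τ_t = Θ(t^{-a})`. -/
def IsStepsize (a : ℝ) (τ : ℕ → ℝ) : Prop :=
  (∀ t, 0 < τ t) ∧ τ =Θ[atTop] (fun t : ℕ => (t : ℝ) ^ (-a))

/-- Nonnegative, nonincreasing smoothing parameters with `β_t = Θ(t^{-b})`. -/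
def IsSmoothing (b : ℝ) (β : ℕ → ℝ) : Prop :=
  (∀ t, 0 ≤ β t) ∧ Antitone β ∧ β =Θ[atTop] (fun t : ℕ => (t : ℝ) ^ (-b))

/-- The average `(1/(T+1)) ∑_{t=0}^T g t`. -/
def runAvg (g : ℕ → ℝ) (T : ℕ) : ℝ :=
  1 / ((T : ℝ) + 1) * ∑ t ∈ Finset.range (T + 1), g t

/-- The bound `O(T^{-r})` on a family of sequences indexed by the runs `(x, y)` satisfying `R`:
the constant depends neither on `T` nor on the run. -/
def HasRate {nx ny : ℕ} (R : (ℕ → Euc nx) → (ℕ → Euc ny) → Prop)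
    (g : (ℕ → Euc nx) → (ℕ → Euc ny) → ℕ → ℝ) (r : ℝ) : Prop :=
  ∃ K : ℝ, ∀ x y, R x y → ∀ T : ℕ, 1 ≤ T → g x y T ≤ K * (T : ℝ) ^ (-r)

/-- The bound `Õ(T^{-r})`: as `HasRate`, up to a power of `log (T + 1)`. -/
def HasRateLog {nx ny : ℕ} (R : (ℕ → Euc nx) → (ℕ → Euc ny) → Prop)
    (g : (ℕ → Euc nx) → (ℕ → Euc ny) → ℕ → ℝ) (r : ℝ) : Prop :=
  ∃ K : ℝ, ∃ k : ℕ, ∀ x y, R x y → ∀ T : ℕ, 1 ≤ T →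
    g x y T ≤ K * (T : ℝ) ^ (-r) * Real.log ((T : ℝ) + 1) ^ k

/-- The average projected-gradient-mapping gap of a run. -/
def avgProjGap {nx ny : ℕ} (X : Set (Euc nx)) (L : Euc nx → Euc ny → ℝ) (σ : ℝ)
    (x : ℕ → Euc nx) (y : ℕ → Euc ny) (T : ℕ) : ℝ :=
  runAvg (fun t => projGap X L σ (x t) (y t)) T

/-- The average dual gap of a run. -/
def avgDualGap {nx ny : ℕ} (Y : Set (Euc ny)) (L : Euc nx → Euc ny → ℝ)
    (x : ℕ → Euc nx) (y : ℕ → Euc ny) (T : ℕ) : ℝ :=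
  runAvg (fun t => dualGap Y L (x t) (y t)) T

end POLMO

end

/-! ### Strong concavity and smoothness -/

namespace POLMO

/-! Write `Φ_β(x)` for the maximum of `L_β(x, ·)` over `Y`, and `h` for the smoothed dual gap. The
proof is a Lyapunov argument for `Φ_β + h = 2 Φ_β - L_β`. With `m_t > 0` a modulus of strong
concavity (`β_t`, or `μ` when there is no smoothing), maximizers are `Lyx / m_t`-Lipschitz in `x`,
and `y_t` lies within `√(2 h / m_t)` of the maximizer. The direction `∇ₓ L(x_t, y_t)` is therefore
an inexact gradient of `Φ_β`, and one iteration (`potential_step`) lowers the potential by the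
Frank-Wolfe progress plus `‖x_{t+1} - x_t‖² / (2 τ_t)`, up to errors of order `τ_t h / m_t` and
`τ_t³ / m_t²`.

The progress is of order `h²` on a general set (`frankWolfe_progress_sq`) and `h √(m_t h)` on a
strongly convex one (`frankWolfe_progress_stronglyConvex`). By Young's inequality half of it absorbs
`τ_t h / m_t`, leaving `τ_t² / m_t²`, respectively `τ_t³ / m_t⁴`. The prescribed exponents make
every remaining error `O(1 / (t + 1))`. Lowering `β` is harmless because `D² β` is added to the
potential (`potential_antitone`).

Summing such errors directly would cost a logarithm. Weighting step `t` by `(t + 1)^(1/4)` before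
summing avoids it (`weighted_sum_le_of_descent`): the errors and the boundary term are then both
`O((T + 1)^(1/4))`. A second Young inequality, with a parameter depending on the horizon `T`, turns
weighted sums of squared steps and of progress into plain sums of gradient mappings and of gaps
(`avgProjGap_rate`, `sum_rates`, `sum_rates_stronglyConvex`). Removing the smoothing adds a bias `D²
β_t`, which decides the dual rate whenever `β_t > 0`. All the bounds come out without logarithms. -/

theorem le_of_forall_small_le_add_mul {a b c : ℝ}
    (h : ∀ s : ℝ, 0 < s → s ≤ 1 → a ≤ b + s * c) : a ≤ b := by
  by_contra! hab
  have hc : 0 < |c| + 1 := by positivity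
  set s := min 1 ((a - b) / (2 * (|c| + 1))) with hs
  have hs0 : 0 < s := lt_min one_pos (div_pos (by linarith) (by positivity))
  have h1 := h s hs0 (min_le_left _ _)
  have h2 : s * (2 * (|c| + 1)) ≤ a - b := by
    rw [← le_div_iff₀ (by positivity)]; exact min_le_right _ _
  have h3 : s * c ≤ s * |c| := by gcongr; exact le_abs_self c
  nlinarith

/-- Maximality at `v` is tested against points of the segment from `v` to `y`; dividing by the step
`s` and letting it tend to zero leaves the full constant `m / 2`. -/
theorem growth_of_strongConcaveOn {E : Type*} [NormedAddCommGroup E] [InnerProductSpace ℝ E]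
    {S : Set E} {f : E → ℝ} {m : ℝ} (hf : StrongConcaveOn S m f)
    {y v : E} (hy : y ∈ S) (hv : v ∈ S) (hmax : ∀ w ∈ S, f w ≤ f v) :
    m / 2 * ‖y - v‖ ^ 2 ≤ f v - f y := by
  refine le_of_forall_small_le_add_mul (c := m / 2 * ‖y - v‖ ^ 2) fun s hs0 hs1 => ?_
  have h := hf.2 hy hv hs0.le (sub_nonneg.2 hs1) (by ring)
  have h2 := h.trans (hmax _ (hf.1 hy hv hs0.le (sub_nonneg.2 hs1) (by ring)))
  simp only [smul_eq_mul] at h2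
  have h3 : s * ((1 - s) * (m / 2 * ‖y - v‖ ^ 2)) ≤ s * (f v - f y) := by linarith
  have h4 := le_of_mul_le_mul_left h3 hs0
  linarith

section Smooth

variable {E : Type*} [NormedAddCommGroup E] [InnerProductSpace ℝ E] [CompleteSpace E]

theorem le_quadratic_of_lipschitz_gradient {S : Set E} (hS : Convex ℝ S) {F : E → ℝ} {F' : E → E}
    {K : ℝ} (hd : ∀ z ∈ S, HasGradientAt F (F' z) z)
    (hL : ∀ z ∈ S, ∀ z' ∈ S, ‖F' z - F' z'‖ ≤ K * ‖z - z'‖) {z z' : E} (hz : z ∈ S)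
    (hz' : z' ∈ S) : F z' ≤ F z + ⟪F' z, z' - z⟫ + K / 2 * ‖z' - z‖ ^ 2 := by
  set d := z' - z with hdd
  have hmem : ∀ s ∈ Set.Icc (0 : ℝ) 1, z + s • d ∈ S := fun s hs =>
    hS.add_smul_sub_mem hz hz' hs
  have hder : ∀ s ∈ Set.Icc (0 : ℝ) 1, HasDerivAt
      (fun s : ℝ => F (z + s • d) - (s * ⟪F' z, d⟫ + K / 2 * ‖d‖ ^ 2 * s ^ 2))
      (⟪F' (z + s • d), d⟫ - (1 * ⟪F' z, d⟫ + K / 2 * ‖d‖ ^ 2 * (2 * s))) s := by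
    intro s hs
    have h1 : HasDerivAt (fun s : ℝ => z + s • d) d s := by
      simpa using ((hasDerivAt_id s).smul_const d).const_add z
    have h2 := ((hd _ (hmem s hs)).hasFDerivAt).comp_hasDerivAt s h1
    have h3 : HasDerivAt (fun s : ℝ => K / 2 * ‖d‖ ^ 2 * s ^ 2) (K / 2 * ‖d‖ ^ 2 * (2 * s)) s := by
      simpa using (hasDerivAt_pow 2 s).const_mul (K / 2 * ‖d‖ ^ 2)
    have h4 : HasDerivAt (fun s : ℝ => s * ⟪F' z, d⟫) (1 * ⟪F' z, d⟫) s :=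
      (hasDerivAt_id s).mul_const _
    exact h2.sub (h4.add h3)
  -- The restriction of `F` to the segment minus its quadratic model has nonpositive derivative;
  -- comparing the endpoints `0` and `1` is the claim.
  have hanti := antitoneOn_of_hasDerivWithinAt_nonpos (convex_Icc (0 : ℝ) 1)
    (fun s hs => (hder s hs).continuousAt.continuousWithinAt)
    (fun s hs => (hder s (interior_subset hs)).hasDerivWithinAt) (by
      intro s hs
      have hs' := interior_subset hs
      have h1 : ⟪F' (z + s • d) - F' z, d⟫ ≤ K * (s * ‖d‖) * ‖d‖ := by
        refine (real_inner_le_norm _ _).trans ?_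
        gcongr
        refine (hL _ (hmem s hs') _ hz).trans (le_of_eq ?_)
        rw [add_sub_cancel_left, norm_smul, Real.norm_of_nonneg hs'.1]
      rw [inner_sub_left] at h1
      nlinarith)
  have := hanti (Set.left_mem_Icc.2 zero_le_one) (Set.right_mem_Icc.2 zero_le_one) zero_le_one
  simp only [one_smul, zero_smul, add_zero, hdd, add_sub_cancel] at this
  norm_num at this
  linarith

theorem quadratic_le_of_lipschitz_gradient {S : Set E} (hS : Convex ℝ S) {F : E → ℝ} {F' : E → E}
    {K : ℝ} (hd : ∀ z ∈ S, HasGradientAt F (F' z) z)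
    (hL : ∀ z ∈ S, ∀ z' ∈ S, ‖F' z - F' z'‖ ≤ K * ‖z - z'‖) {z z' : E} (hz : z ∈ S)
    (hz' : z' ∈ S) : F z + ⟪F' z, z' - z⟫ - K / 2 * ‖z' - z‖ ^ 2 ≤ F z' := by
  have := le_quadratic_of_lipschitz_gradient hS (F := fun z => - F z) (F' := fun z => - F' z)
    (K := K) (fun z hz => by
      have := (hd z hz).hasFDerivAt.neg
      rw [hasGradientAt_iff_hasFDerivAt, map_neg]
      exact this)
    (fun z hz z' hz' => by
      rw [neg_sub_neg, norm_sub_rev]; exact hL z hz z' hz') hz hz'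
  simp only [inner_neg_left] at this
  linarith

theorem sub_le_inner_gradient_of_concaveOn {S : Set E} {F : E → ℝ} {F' : E → E}
    {K : ℝ} (hF : ConcaveOn ℝ S F) (hd : ∀ z ∈ S, HasGradientAt F (F' z) z)
    (hL : ∀ z ∈ S, ∀ z' ∈ S, ‖F' z - F' z'‖ ≤ K * ‖z - z'‖) {y v : E} (hy : y ∈ S)
    (hv : v ∈ S) : F v - F y ≤ ⟪F' y, v - y⟫ := by
  refine le_of_forall_small_le_add_mul (c := K / 2 * ‖v - y‖ ^ 2) fun s hs0 hs1 => ?_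
  have h := hF.2 hy hv (sub_nonneg.2 hs1) hs0.le (by ring)
  have hmem := hF.1 hy hv (sub_nonneg.2 hs1) hs0.le (by ring)
  have h2 := le_quadratic_of_lipschitz_gradient hF.1 hd hL hy hmem
  have h3 : (1 - s) • y + s • v - y = s • (v - y) := by module
  rw [h3, inner_smul_right, norm_smul, Real.norm_of_nonneg hs0.le] at h2
  simp only [smul_eq_mul] at h
  have h3 : s * (F v - F y) ≤ s * (⟪F' y, v - y⟫ + s * (K / 2 * ‖v - y‖ ^ 2)) := by nlinarith
  exact le_of_mul_le_mul_left h3 hs0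

/-- The maximizers of two strongly concave functions are close if their gradients are. -/
theorem dist_maximizers_le {S : Set E} {f₁ f₂ : E → ℝ} {f₁' f₂' : E → E} {m δ : ℝ}
    (h₁ : StrongConcaveOn S m f₁) (h₂ : StrongConcaveOn S m f₂)
    (hd₁ : ∀ z ∈ S, HasGradientAt f₁ (f₁' z) z) (hd₂ : ∀ z ∈ S, HasGradientAt f₂ (f₂' z) z)
    (hδ : ∀ z ∈ S, ‖f₁' z - f₂' z‖ ≤ δ) {v₁ v₂ : E} (hv₁ : v₁ ∈ S) (hv₂ : v₂ ∈ S)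
    (hm₁ : ∀ w ∈ S, f₁ w ≤ f₁ v₁) (hm₂ : ∀ w ∈ S, f₂ w ≤ f₂ v₂) :
    m * ‖v₂ - v₁‖ ≤ δ := by
  have g₁ := growth_of_strongConcaveOn h₁ hv₂ hv₁ hm₁
  have g₂ := growth_of_strongConcaveOn h₂ hv₁ hv₂ hm₂
  rw [norm_sub_rev] at g₂
  -- Adding the two growth inequalities bounds `m ‖v₂ - v₁‖²` by an increment of `f₁ - f₂`, which is
  -- `δ`-Lipschitz by the mean value inequality.
  have key := h₁.1.norm_image_sub_le_of_norm_hasFDerivWithin_le (f := fun z => f₁ z - f₂ z)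
    (fun z hz => ((hd₁ z hz).hasFDerivAt.sub (hd₂ z hz).hasFDerivAt).hasFDerivWithinAt)
    (C := δ) (fun z hz => by
      rw [← map_sub, LinearIsometryEquiv.norm_map]; exact hδ z hz) hv₂ hv₁
  have h3 := (le_abs_self _).trans key
  rw [norm_sub_rev v₁ v₂] at h3
  rcases (norm_nonneg (v₂ - v₁)).eq_or_lt with h0 | h0
  · rw [← h0, mul_zero]; exact (norm_nonneg _).trans (hδ _ hv₁)
  · refine le_of_mul_le_mul_right ?_ h0
    nlinarith

end Smooth

/-! ### Progress of a Frank-Wolfe step -/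

section FrankWolfe

variable {E : Type*} [NormedAddCommGroup E] [InnerProductSpace ℝ E] [CompleteSpace E]

/-- A short Frank-Wolfe step stays in the set and makes progress. -/
theorem frankWolfe_progress {S : Set E} {f : E → ℝ} {f' : E → E} {K m : ℝ} (hm : 0 < m)
    (hf : StrongConcaveOn S m f) (hd : ∀ z ∈ S, HasGradientAt f (f' z) z)
    (hL : ∀ z ∈ S, ∀ z' ∈ S, ‖f' z - f' z'‖ ≤ K * ‖z - z'‖) (hK : 0 ≤ K) {y u y' : E}
    (hy : y ∈ S) (hu : u ∈ S) (hmax : ∀ w ∈ S, ⟪f' y, w⟫ ≤ ⟪f' y, u⟫)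
    (hy' : y' = y + (min (⟪f' y, u - y⟫ / (K * ‖u - y‖ ^ 2)) 1) • (u - y)) :
    y' ∈ S ∧ 0 ≤ ⟪f' y, u - y⟫ ∧ (f y + ⟪f' y, u - y⟫ / 2 ≤ f y' ∨
      (0 < K * ‖u - y‖ ^ 2 ∧ f y + ⟪f' y, u - y⟫ ^ 2 / (2 * (K * ‖u - y‖ ^ 2)) ≤ f y')) := by
  have hconv : Convex ℝ S := hf.1
  set g := ⟪f' y, u - y⟫ with hg
  have hg0 : 0 ≤ g := by rw [hg, inner_sub_right]; linarith [hmax y hy]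
  set γ := min (g / (K * ‖u - y‖ ^ 2)) 1 with hγ
  have hγ0 : 0 ≤ γ := le_min (div_nonneg hg0 (by positivity)) zero_le_one
  have hγ1 : γ ≤ 1 := min_le_right _ _
  have hmem : y' ∈ S := hy' ▸ hconv.add_smul_sub_mem hy hu ⟨hγ0, hγ1⟩
  refine ⟨hmem, hg0, ?_⟩
  have hq := quadratic_le_of_lipschitz_gradient hconv hd hL hy hmem
  rw [hy', add_sub_cancel_left, inner_smul_right, norm_smul, Real.norm_of_nonneg hγ0, ← hy',
    ← hg] at hq
  by_cases h0 : u = y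
  · left
    have hyy : y' = y := by rw [hy', h0]; simp
    have : g = 0 := by rw [hg, h0]; simp
    rw [hyy, this]; simp
  have hn : 0 < ‖u - y‖ := norm_pos_iff.2 (sub_ne_zero.2 h0)
  -- If `K = 0`, the smoothness bounds force `f` to be affine enough along the segment to contradict
  -- strong concavity at its midpoint.
  have hK0 : 0 < K := by
    refine lt_of_le_of_ne hK fun hK0 => ?_
    have hmid : (1 / 2 : ℝ) • y + (1 / 2 : ℝ) • u ∈ S :=
      hconv hy hu (by norm_num) (by norm_num) (by norm_num)
    have h1 := hf.2 hy hu (show (0 : ℝ) ≤ 1 / 2 by norm_num) (show (0 : ℝ) ≤ 1 / 2 by norm_num)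
      (by norm_num)
    have h2 := le_quadratic_of_lipschitz_gradient hconv hd hL hy hmid
    have h3 := quadratic_le_of_lipschitz_gradient hconv hd hL hy hu
    have h4 : (1 / 2 : ℝ) • y + (1 / 2 : ℝ) • u - y = (1 / 2 : ℝ) • (u - y) := by module
    rw [h4, inner_smul_right, ← hK0] at h2
    rw [← hK0] at h3
    rw [norm_sub_rev y u] at h1
    simp only [smul_eq_mul] at h1
    have : 0 < m * ‖u - y‖ ^ 2 := by positivity
    nlinarith
  have hpos : 0 < K * ‖u - y‖ ^ 2 := by positivity
  -- An unclipped step maximizes the quadratic lower model exactly; a clipped one has `g > K ‖u -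
  -- y‖²`, so the quadratic term costs at most half of the linear gain.
  by_cases hc : g / (K * ‖u - y‖ ^ 2) ≤ 1
  · right
    refine ⟨hpos, ?_⟩
    have hγ' : γ = g / (K * ‖u - y‖ ^ 2) := min_eq_left hc
    have h5 : γ * g - K / 2 * (γ * ‖u - y‖) ^ 2 = g ^ 2 / (2 * (K * ‖u - y‖ ^ 2)) := by
      rw [hγ']; field_simp; ring
    linarith
  · left
    have hγ' : γ = 1 := min_eq_right (not_le.1 hc).le
    rw [not_le, lt_div_iff₀ hpos] at hc
    rw [hγ'] at hq
    nlinarith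

/-- The linear gap dominates the true gap `h` by concavity. The two conditions on `c` bring the
clipped gain `g / 2` and the unclipped gain `g² / (2 K ‖u - y‖²)` to the common form `c h²`. -/
theorem frankWolfe_progress_sq {S : Set E} {f : E → ℝ} {f' : E → E} {K m : ℝ} (hm : 0 < m)
    (hf : StrongConcaveOn S m f) (hd : ∀ z ∈ S, HasGradientAt f (f' z) z)
    (hL : ∀ z ∈ S, ∀ z' ∈ S, ‖f' z - f' z'‖ ≤ K * ‖z - z'‖) (hK : 0 ≤ K) {y u y' v : E}
    (hy : y ∈ S) (hu : u ∈ S) (hmax : ∀ w ∈ S, ⟪f' y, w⟫ ≤ ⟪f' y, u⟫)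
    (hy' : y' = y + (min (⟪f' y, u - y⟫ / (K * ‖u - y‖ ^ 2)) 1) • (u - y))
    (hv : v ∈ S) (hvmax : ∀ w ∈ S, f w ≤ f v) {c H D : ℝ} (hc : 0 ≤ c)
    (hH : f v - f y ≤ H) (hD : ‖u - y‖ ≤ D) (hcH : c * H ≤ 1 / 2) (hcD : 2 * c * K * D ^ 2 ≤ 1) :
    f y + c * (f v - f y) ^ 2 ≤ f y' := by
  obtain ⟨-, hg0, hs⟩ := frankWolfe_progress hm hf hd hL hK hy hu hmax hy'
  have hconc : ConcaveOn ℝ S f := hf.concaveOn fun r => by positivity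
  have hg : f v - f y ≤ ⟪f' y, u - y⟫ :=
    (sub_le_inner_gradient_of_concaveOn hconc hd hL hy hv).trans (by
      rw [inner_sub_right, inner_sub_right]; linarith [hmax v hv])
  have hh : 0 ≤ f v - f y := sub_nonneg.2 (hvmax y hy)
  set g := ⟪f' y, u - y⟫
  set h := f v - f y
  rcases hs with hs | ⟨hpos, hs⟩
  · have h1 : c * h * h ≤ 1 / 2 * h := by
      gcongr
      exact (mul_le_mul_of_nonneg_left hH hc).trans hcH
    nlinarith
  · have h2 : c * h ^ 2 ≤ g ^ 2 / (2 * (K * ‖u - y‖ ^ 2)) := by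
      rw [le_div_iff₀ (by positivity)]
      have h3 : 2 * c * K * ‖u - y‖ ^ 2 ≤ 1 := le_trans (by gcongr) hcD
      calc c * h ^ 2 * (2 * (K * ‖u - y‖ ^ 2)) = (2 * c * K * ‖u - y‖ ^ 2) * h ^ 2 := by ring
        _ ≤ 1 * h ^ 2 := by gcongr
        _ ≤ g ^ 2 := by rw [one_mul]; gcongr
    linarith

end FrankWolfe

/-- Over a strongly convex set the linear gap dominates the squared length of the step. -/
theorem IsStronglyConvexSet.linear_gap {n : ℕ} {α : ℝ} {Y : Set (Euc n)}
    (hY : IsStronglyConvexSet α Y) {d y u : Euc n} (hy : y ∈ Y) (hu : u ∈ Y)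
    (hmax : ∀ w ∈ Y, ⟪d, w⟫ ≤ ⟪d, u⟫) : α / 4 * ‖u - y‖ ^ 2 * ‖d‖ ≤ ⟪d, u - y⟫ := by
  by_cases h0 : d = 0
  · simp [h0]
  have hn : ‖d‖ ≠ 0 := norm_ne_zero_iff.2 h0
  have hz : ‖‖d‖⁻¹ • d‖ = 1 := by
    rw [norm_smul, norm_inv, norm_norm, inv_mul_cancel₀ hn]
  -- Optimality of `u` is tested at the midpoint of `u` and `y`, pushed by `α / 8 * ‖u - y‖²` along
  -- the unit vector in direction `d`.
  have h := hmax _ (hY u hu y hy _ hz (1 / 2) ⟨by norm_num, by norm_num⟩)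
  rw [inner_add_right, inner_add_right, inner_smul_right, inner_smul_right, inner_smul_right,
    inner_smul_right, real_inner_self_eq_norm_sq] at h
  have h1 : ‖d‖⁻¹ * ‖d‖ ^ 2 = ‖d‖ := by field_simp
  rw [h1] at h
  rw [inner_sub_right]
  linarith

/-- Strong convexity of the set gives `‖u - y‖² ≤ 4 g / (α ‖∇f‖)` for a nonzero gradient, so an
unclipped step gains a multiple of `g ‖∇f‖`. Strong concavity of `f` bounds `‖∇f‖` below by a
multiple of `√(m h)`. -/
theorem frankWolfe_progress_stronglyConvex {n : ℕ} {α : ℝ} {S : Set (Euc n)}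
    (hα : IsStronglyConvexSet α S) {f : Euc n → ℝ} {f' : Euc n → Euc n} {K m : ℝ} (hm : 0 < m)
    (hf : StrongConcaveOn S m f) (hd : ∀ z ∈ S, HasGradientAt f (f' z) z)
    (hL : ∀ z ∈ S, ∀ z' ∈ S, ‖f' z - f' z'‖ ≤ K * ‖z - z'‖) (hK : 0 ≤ K) {y u y' v : Euc n}
    (hy : y ∈ S) (hu : u ∈ S) (hmax : ∀ w ∈ S, ⟪f' y, w⟫ ≤ ⟪f' y, u⟫)
    (hy' : y' = y + (min (⟪f' y, u - y⟫ / (K * ‖u - y‖ ^ 2)) 1) • (u - y))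
    (hv : v ∈ S) (hvmax : ∀ w ∈ S, f w ≤ f v) {c H : ℝ} (hc : 0 ≤ c)
    (hH : f v - f y ≤ H) (hcH : c * √(m * H) ≤ 1 / 2) (hcα : 16 * c * K ≤ α) :
    f y + c * (f v - f y) * √(m * (f v - f y)) ≤ f y' := by
  obtain ⟨-, hg0, hs⟩ := frankWolfe_progress hm hf hd hL hK hy hu hmax hy'
  have hconc : ConcaveOn ℝ S f := hf.concaveOn fun r => by positivity
  have hgv : f v - f y ≤ ⟪f' y, v - y⟫ := sub_le_inner_gradient_of_concaveOn hconc hd hL hy hv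
  have hg : f v - f y ≤ ⟪f' y, u - y⟫ := hgv.trans (by
      rw [inner_sub_right, inner_sub_right]; linarith [hmax v hv])
  have hh : 0 ≤ f v - f y := sub_nonneg.2 (hvmax y hy)
  have hgrow := growth_of_strongConcaveOn hf hy hv hvmax
  have hsc := hα.linear_gap hy hu hmax
  have hcs := hgv.trans (real_inner_le_norm _ _)
  rw [norm_sub_rev] at hcs
  set g := ⟪f' y, u - y⟫
  set h := f v - f y
  set N := ‖f' y‖ with hN
  have hN0 : 0 ≤ N := norm_nonneg _
  -- From `h ≤ N ‖y - v‖` and `m / 2 * ‖y - v‖² ≤ h` one gets `m h ≤ 2 N²`.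
  have hgrad : √(m * h) ≤ 2 * N := by
    refine Real.sqrt_le_iff.2 ⟨by positivity, ?_⟩
    rcases hh.eq_or_lt with h0 | h0
    · rw [← h0, mul_zero]; positivity
    refine le_of_mul_le_mul_right ?_ h0
    have h1 : h ^ 2 ≤ (N * ‖y - v‖) ^ 2 := by gcongr
    have h2 : m * h ^ 2 ≤ N ^ 2 * (m * ‖y - v‖ ^ 2) := by nlinarith
    have h3 : N ^ 2 * (m * ‖y - v‖ ^ 2) ≤ N ^ 2 * (2 * h) := by gcongr 1; linarith
    nlinarith [mul_nonneg (sq_nonneg N) hh]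
  rcases hs with hs | ⟨hpos, hs⟩
  · have h1 : c * √(m * h) ≤ 1 / 2 := le_trans (by gcongr) hcH
    nlinarith
  · have h2 : c * h * √(m * h) ≤ g ^ 2 / (2 * (K * ‖u - y‖ ^ 2)) := by
      rw [le_div_iff₀ (by positivity)]
      calc c * h * √(m * h) * (2 * (K * ‖u - y‖ ^ 2))
          ≤ c * h * (2 * N) * (2 * (K * ‖u - y‖ ^ 2)) := by gcongr
        _ = h * ((16 * c * K) / 4 * ‖u - y‖ ^ 2 * N) := by ring
        _ ≤ h * (α / 4 * ‖u - y‖ ^ 2 * N) := by gcongr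
        _ ≤ h * g := by gcongr
        _ ≤ g * g := by gcongr
        _ = g ^ 2 := by ring
    linarith

/-! ### Projected gradient steps -/

section Projection

variable {n : ℕ}

theorem IsProjection.inner_le_zero {C : Set (Euc n)} (hC : Convex ℝ C) {u p : Euc n}
    (hp : IsProjection C u p) {v : Euc n} (hv : v ∈ C) : ⟪u - p, v - p⟫ ≤ 0 := by
  have : ⟪u - p, v - p⟫ * 2 ≤ 0 := by
    refine le_of_forall_small_le_add_mul (c := ‖v - p‖ ^ 2) fun s hs0 hs1 => ?_
    have h := hp.2 _ (hC.add_smul_sub_mem hp.1 hv ⟨hs0.le, hs1⟩)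
    have h1 : u - (p + s • (v - p)) = (u - p) - s • (v - p) := by abel
    rw [h1, norm_sub_sq_real (u - p), inner_smul_right, norm_smul, Real.norm_of_nonneg hs0.le] at h
    have h2 : s * (⟪u - p, v - p⟫ * 2) ≤ s * (0 + s * ‖v - p‖ ^ 2) := by nlinarith
    exact le_of_mul_le_mul_left h2 hs0
  linarith

/-- The variational inequality of the projection, tested at the base point `x` itself. -/
theorem inner_PO_step_le {X : Set (Euc n)} (hX : IsCompact X) (hc : Convex ℝ X) {x g : Euc n}
    (hx : x ∈ X) (τ : ℝ) :
    ‖PO X (x - τ • g) - x‖ ^ 2 ≤ -(τ * ⟪g, PO X (x - τ • g) - x⟫) := by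
  have h := (PO_spec hX ⟨x, hx⟩ (x - τ • g)).inner_le_zero hc hx
  set p := PO X (x - τ • g)
  have h1 : x - τ • g - p = -(p - x) - τ • g := by abel
  have h2 : x - p = -(p - x) := by abel
  rw [h1, h2, inner_sub_left, inner_neg_neg, inner_neg_right, inner_smul_left,
    real_inner_self_eq_norm_sq] at h
  simp only [conj_trivial] at h
  linarith

theorem norm_PO_step_le {X : Set (Euc n)} (hX : IsCompact X) (hc : Convex ℝ X) {x g : Euc n}
    (hx : x ∈ X) {τ : ℝ} (hτ : 0 < τ) : ‖PO X (x - τ • g) - x‖ ≤ τ * ‖g‖ := by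
  have h := inner_PO_step_le hX hc (g := g) hx τ
  have h2 := neg_le_of_abs_le (abs_real_inner_le_norm g (PO X (x - τ • g) - x))
  set N := ‖PO X (x - τ • g) - x‖ with hN
  rcases (norm_nonneg (PO X (x - τ • g) - x)).eq_or_lt with h0 | h0
  · rw [hN, ← h0]; positivity
  · refine le_of_mul_le_mul_right ?_ h0
    nlinarith

/-- The gradient mapping with stepsize `σ` is controlled by the one with stepsize `τ`. -/
theorem norm_PO_step_div_le {X : Set (Euc n)} (hX : IsCompact X) (hc : Convex ℝ X) {x g : Euc n}
    (hx : x ∈ X) {σ τ : ℝ} (hσ : 0 < σ) (hτ : 0 < τ) :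
    ‖PO X (x - σ • g) - x‖ / σ ≤ max 1 (τ / σ) * (‖PO X (x - τ • g) - x‖ / τ) := by
  have hp := PO_spec hX ⟨x, hx⟩ (x - σ • g)
  have hq := PO_spec hX ⟨x, hx⟩ (x - τ • g)
  have h1 := hp.inner_le_zero hc hq.1
  have h2 := hq.inner_le_zero hc hp.1
  set p' := PO X (x - σ • g)
  set q' := PO X (x - τ • g)
  set p := p' - x with hpd
  set q := q' - x with hqd
  have e1 : x - σ • g - p' = -p - σ • g := by rw [hpd]; abel
  have e2 : x - τ • g - q' = -q - τ • g := by rw [hqd]; abel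
  have e3 : q' - p' = q - p := by rw [hpd, hqd]; abel
  have e4 : p' - q' = p - q := by rw [hpd, hqd]; abel
  rw [e1, e3] at h1
  rw [e2, e4] at h2
  simp only [inner_sub_left, inner_sub_right, inner_neg_left, inner_smul_left, conj_trivial,
    real_inner_self_eq_norm_sq] at h1 h2
  rw [real_inner_comm p q] at h2
  -- Weighting the two variational inequalities by `τ` and `σ` eliminates `g`. After Cauchy-Schwarz
  -- the result factors as in `h5`: the step length grows with the stepsize, while its ratio to the
  -- stepsize falls.
  have h3 : τ * ‖p‖ ^ 2 + σ * ‖q‖ ^ 2 ≤ (τ + σ) * ⟪p, q⟫ := by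
    nlinarith
  have h4 : (τ + σ) * ⟪p, q⟫ ≤ (τ + σ) * (‖p‖ * ‖q‖) := by
    gcongr; exact real_inner_le_norm _ _
  have h5 : (τ * ‖p‖ - σ * ‖q‖) * (‖p‖ - ‖q‖) ≤ 0 := by nlinarith
  have hp0 := norm_nonneg p
  have hq0 := norm_nonneg q
  rcases le_total τ σ with h | h
  · have h6 : τ * ‖p‖ ≤ σ * ‖q‖ := by
      by_contra! h7
      have : ‖q‖ < ‖p‖ := by nlinarith
      nlinarith
    calc ‖p‖ / σ ≤ ‖q‖ / τ := by rw [div_le_div_iff₀ hσ hτ]; linarith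
      _ ≤ max 1 (τ / σ) * (‖q‖ / τ) := le_mul_of_one_le_left (by positivity) (le_max_left _ _)
  · have h6 : ‖p‖ ≤ ‖q‖ := by
      by_contra! h7
      have : σ * ‖q‖ < τ * ‖p‖ := by nlinarith
      nlinarith
    calc ‖p‖ / σ ≤ ‖q‖ / σ := by gcongr
      _ = τ / σ * (‖q‖ / τ) := by field_simp
      _ ≤ max 1 (τ / σ) * (‖q‖ / τ) := by gcongr; exact le_max_right _ _

end Projection

end POLMO

/-! ### Regularized payoff and one-step descent of the potential -/

namespace POLMO

variable {nx ny : ℕ} {X : Set (Euc nx)} {Y : Set (Euc ny)} {L : Euc nx → Euc ny → ℝ}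
  {μ Lxx Lyx Lyy : ℝ}

namespace StandingAssumption

theorem differentiableAt_uncurry (hA : StandingAssumption X Y L μ Lxx Lyx Lyy) {x : Euc nx}
    {y : Euc ny} (hx : x ∈ X) (hy : y ∈ Y) :
    DifferentiableAt ℝ (fun p : Euc nx × Euc ny => L p.1 p.2) (x, y) := by
  obtain ⟨U, hU, hsub, hC⟩ := hA.differentiable
  exact (hC.differentiableOn (by norm_num)).differentiableAt (hU.mem_nhds (hsub ⟨hx, hy⟩))

theorem hasGradientAt_fst (hA : StandingAssumption X Y L μ Lxx Lyx Lyy) {x : Euc nx}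
    {y : Euc ny} (hx : x ∈ X) (hy : y ∈ Y) :
    HasGradientAt (fun x' => L x' y) (gradX L x y) x := by
  refine DifferentiableAt.hasGradientAt ?_
  exact (hA.differentiableAt_uncurry hx hy).comp (f := fun x' => (x', y)) x (by fun_prop)

theorem hasGradientAt_snd (hA : StandingAssumption X Y L μ Lxx Lyx Lyy) {x : Euc nx}
    {y : Euc ny} (hx : x ∈ X) (hy : y ∈ Y) :
    HasGradientAt (fun y' => L x y') (gradY L x y) y := by
  refine DifferentiableAt.hasGradientAt ?_
  exact (hA.differentiableAt_uncurry hx hy).comp (f := fun y' => (x, y')) y (by fun_prop)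

theorem hasGradientAt_regPayoff (hA : StandingAssumption X Y L μ Lxx Lyx Lyy) (y₀ : Euc ny)
    (β : ℝ) {x : Euc nx} {y : Euc ny} (hx : x ∈ X) (hy : y ∈ Y) :
    HasGradientAt (regPayoff L y₀ β x) (gradY (regPayoff L y₀ β) x y) y ∧
      gradY (regPayoff L y₀ β) x y = gradY L x y - β • (y - y₀) := by
  have h1 : HasGradientAt (fun y' => L x y' - β / 2 * ‖y' - y₀‖ ^ 2)
      (gradY L x y - β • (y - y₀)) y := by
    have h2 : HasFDerivAt (fun y' : Euc ny => y' - y₀) (ContinuousLinearMap.id ℝ (Euc ny)) y :=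
      (hasFDerivAt_id y).sub_const y₀
    have h3 := (h2.norm_sq.const_mul (β / 2))
    have h4 := (hA.hasGradientAt_snd hx hy).hasFDerivAt.sub h3
    rw [hasGradientAt_iff_hasFDerivAt]
    have h5 : InnerProductSpace.toDual ℝ (Euc ny) (gradY L x y - β • (y - y₀)) =
        InnerProductSpace.toDual ℝ (Euc ny) (gradY L x y) -
          (β / 2) • 2 • (innerSL ℝ) (y - y₀) ∘SL ContinuousLinearMap.id ℝ (Euc ny) := by
      ext v
      simp
      ring
    rw [h5]
    exact h4
  have h5 : gradY (regPayoff L y₀ β) x y = gradY L x y - β • (y - y₀) := h1.gradient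
  exact ⟨h5 ▸ h1, h5⟩

theorem lipschitz_gradY_regPayoff (hA : StandingAssumption X Y L μ Lxx Lyx Lyy) (y₀ : Euc ny)
    {β : ℝ} (hβ : 0 ≤ β) {x : Euc nx} (hx : x ∈ X) {y y' : Euc ny} (hy : y ∈ Y) (hy' : y' ∈ Y) :
    ‖gradY (regPayoff L y₀ β) x y - gradY (regPayoff L y₀ β) x y'‖ ≤ (Lyy + β) * ‖y - y'‖ := by
  rw [(hA.hasGradientAt_regPayoff y₀ β hx hy).2, (hA.hasGradientAt_regPayoff y₀ β hx hy').2]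
  have h1 : gradY L x y - β • (y - y₀) - (gradY L x y' - β • (y' - y₀)) =
      (gradY L x y - gradY L x y') - β • (y - y') := by module
  have h2 := hA.lipschitzY x hx y hy x hx y' hy'
  rw [sub_self, norm_zero, mul_zero, zero_add] at h2
  rw [h1]
  refine (norm_sub_le _ _).trans ?_
  rw [norm_smul, Real.norm_of_nonneg hβ]
  linarith

theorem strongConcaveOn_regPayoff (hA : StandingAssumption X Y L μ Lxx Lyx Lyy) (y₀ : Euc ny)
    {β m : ℝ} (hm : m ≤ μ + β) {x : Euc nx} (hx : x ∈ X) :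
    StrongConcaveOn Y m (regPayoff L y₀ β x) := by
  refine ⟨hA.convexY, fun y hy y' hy' a b ha hb hab => ?_⟩
  have h := (hA.concave x hx).2 hy hy' ha hb hab
  simp only [smul_eq_mul, regPayoff] at h ⊢
  have hb' : b = 1 - a := by linarith
  have h1 : a • y + b • y' - y₀ = a • (y - y₀) + b • (y' - y₀) := by subst hb'; module
  have h2 : y - y' = (y - y₀) - (y' - y₀) := by abel
  have h3 : ‖a • y + b • y' - y₀‖ ^ 2 =
      a * ‖y - y₀‖ ^ 2 + b * ‖y' - y₀‖ ^ 2 - a * b * ‖y - y'‖ ^ 2 := by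
    rw [h1, h2, norm_add_sq_real, norm_sub_sq_real (y - y₀), norm_smul, norm_smul,
      Real.norm_of_nonneg ha, Real.norm_of_nonneg hb, inner_smul_left, inner_smul_right]
    simp only [conj_trivial]
    subst hb'
    ring
  rw [h3]
  have h4 : a * b * (m / 2 * ‖y - y'‖ ^ 2) ≤ a * b * ((μ + β) / 2 * ‖y - y'‖ ^ 2) := by gcongr
  nlinarith

theorem exists_maximizer (hA : StandingAssumption X Y L μ Lxx Lyx Lyy) (y₀ : Euc ny) (β : ℝ)
    (hY : Y.Nonempty) {x : Euc nx} (hx : x ∈ X) :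
    ∃ v ∈ Y, (∀ w ∈ Y, regPayoff L y₀ β x w ≤ regPayoff L y₀ β x v) ∧
      sSup (regPayoff L y₀ β x '' Y) = regPayoff L y₀ β x v := by
  obtain ⟨v, hv, hmax⟩ := hA.compactY.exists_isMaxOn hY (f := regPayoff L y₀ β x)
    (fun y hy => (hA.hasGradientAt_regPayoff y₀ β hx hy).1.differentiableAt.continuousAt.continuousWithinAt)
  refine ⟨v, hv, fun w hw => hmax hw, ?_⟩
  refine IsGreatest.csSup_eq ⟨⟨v, hv, rfl⟩, ?_⟩
  rintro _ ⟨w, hw, rfl⟩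
  exact hmax hw

theorem lipschitz_gradX_left (hA : StandingAssumption X Y L μ Lxx Lyx Lyy) {y : Euc ny}
    (hy : y ∈ Y) : ∀ x ∈ X, ∀ x' ∈ X, ‖gradX L x y - gradX L x' y‖ ≤ Lxx * ‖x - x'‖ := by
  intro x hx x' hx'
  simpa using hA.lipschitzX x hx y hy x' hx' y hy

theorem lipschitz_gradX_right (hA : StandingAssumption X Y L μ Lxx Lyx Lyy) {x : Euc nx}
    (hx : x ∈ X) {y y' : Euc ny} (hy : y ∈ Y) (hy' : y' ∈ Y) :
    ‖gradX L x y - gradX L x y'‖ ≤ Lyx * ‖y - y'‖ := by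
  simpa using hA.lipschitzX x hx y hy x hx y' hy'

/-- The regularization terms cancel in the difference of the gradients at `x` and `x'`, so the
constant involves `β` only through `m`. -/
theorem dist_argmax_le (hA : StandingAssumption X Y L μ Lxx Lyx Lyy) (y₀ : Euc ny)
    {β m : ℝ} (hm : m ≤ μ + β) {x x' : Euc nx} (hx : x ∈ X) (hx' : x' ∈ X) {v v' : Euc ny}
    (hv : v ∈ Y) (hv' : v' ∈ Y) (hmax : ∀ w ∈ Y, regPayoff L y₀ β x w ≤ regPayoff L y₀ β x v)
    (hmax' : ∀ w ∈ Y, regPayoff L y₀ β x' w ≤ regPayoff L y₀ β x' v') :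
    m * ‖v' - v‖ ≤ Lyx * ‖x' - x‖ := by
  refine dist_maximizers_le (hA.strongConcaveOn_regPayoff y₀ hm hx)
    (hA.strongConcaveOn_regPayoff y₀ hm hx')
    (fun z hz => (hA.hasGradientAt_regPayoff y₀ β hx hz).1)
    (fun z hz => (hA.hasGradientAt_regPayoff y₀ β hx' hz).1) (fun z hz => ?_) hv hv' hmax hmax'
  rw [(hA.hasGradientAt_regPayoff y₀ β hx hz).2, (hA.hasGradientAt_regPayoff y₀ β hx' hz).2,
    sub_sub_sub_cancel_right, norm_sub_rev x' x]
  simpa using hA.lipschitzY x hx z hz x' hx' z hz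

end StandingAssumption

/-- The smoothed primal function plus the smoothed dual gap. -/
noncomputable def potential (Y : Set (Euc ny)) (L : Euc nx → Euc ny → ℝ) (y₀ : Euc ny) (β : ℝ)
    (x : Euc nx) (y : Euc ny) : ℝ :=
  sSup (regPayoff L y₀ β x '' Y) + dualGap Y (regPayoff L y₀ β) x y

/-- The potential equals `2 Φ_β(x) - L_β(x, y)`, so its first-order change involves `2 ∇ₓL(x, v') -
∇ₓL(x, y')`. Split this as `∇ₓL(x, y)` plus differences of gradients against the maximizer `v`. The
first part yields `-N² / τ`; the errors, including the curvature term, consume half of that. No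
smallness of `τ` is needed. -/
theorem StandingAssumption.potential_step (hA : StandingAssumption X Y L μ Lxx Lyx Lyy)
    {y₀ : Euc ny} {β m : ℝ} (hm0 : 0 < m) (hm : m ≤ μ + β) {x : Euc nx} {y y' : Euc ny}
    (hx : x ∈ X) (hy : y ∈ Y) (hy' : y' ∈ Y) {τ M p : ℝ} (hτ : 0 < τ)
    (hM : ‖gradX L x y‖ ≤ M) (hp : 0 ≤ p)
    (hprog : regPayoff L y₀ β x y + p ≤ regPayoff L y₀ β x y') :
    potential Y L y₀ β (PO X (x - τ • gradX L x y)) y' + p +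
        ‖PO X (x - τ • gradX L x y) - x‖ ^ 2 / (2 * τ) ≤
      potential Y L y₀ β x y + 8 * Lyx ^ 2 * (τ * dualGap Y (regPayoff L y₀ β) x y / m) +
        16 * (Lxx + Lyx ^ 2 / m) ^ 2 * M ^ 2 * τ ^ 3 := by
  set x' := PO X (x - τ • gradX L x y) with hx'd
  have hx' : x' ∈ X := (PO_spec hA.compactX ⟨x, hx⟩ _).1
  obtain ⟨v, hv, hmax, hS⟩ := hA.exists_maximizer y₀ β ⟨y, hy⟩ hx
  obtain ⟨v', hv', hmax', hS'⟩ := hA.exists_maximizer y₀ β ⟨y, hy⟩ hx'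
  have hdist := hA.dist_argmax_le y₀ hm hx hx' hv hv' hmax hmax'
  have hN := norm_PO_step_le hA.compactX hA.convexX (g := gradX L x y) hx hτ
  have hVI := inner_PO_step_le hA.compactX hA.convexX (g := gradX L x y) hx τ
  rw [← hx'd] at hN hVI
  simp only [potential, dualGap, hS, hS']
  have hgr := growth_of_strongConcaveOn (hA.strongConcaveOn_regPayoff y₀ hm hx) hy hv hmax
  have hgr' := growth_of_strongConcaveOn (hA.strongConcaveOn_regPayoff y₀ hm hx) hy' hv hmax
  have hup := le_quadratic_of_lipschitz_gradient hA.convexX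
    (fun z hz => hA.hasGradientAt_fst hz hv') (hA.lipschitz_gradX_left hv') hx hx'
  have hlo := quadratic_le_of_lipschitz_gradient hA.convexX
    (fun z hz => hA.hasGradientAt_fst hz hy') (hA.lipschitz_gradX_left hy') hx hx'
  have c1 : ⟪gradX L x v' - gradX L x v, x' - x⟫ ≤ Lyx * ‖v' - v‖ * ‖x' - x‖ :=
    (real_inner_le_norm _ _).trans (by gcongr; exact hA.lipschitz_gradX_right hx hv' hv)
  have c2 : ⟪gradX L x v - gradX L x y, x' - x⟫ ≤ Lyx * ‖y - v‖ * ‖x' - x‖ :=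
    (real_inner_le_norm _ _).trans (by
      rw [norm_sub_rev y v]; gcongr; exact hA.lipschitz_gradX_right hx hv hy)
  have c3 : ⟪gradX L x v - gradX L x y', x' - x⟫ ≤ Lyx * ‖y' - v‖ * ‖x' - x‖ :=
    (real_inner_le_norm _ _).trans (by
      rw [norm_sub_rev y' v]; gcongr; exact hA.lipschitz_gradX_right hx hv hy')
  rw [inner_sub_left] at c1 c2 c3
  have hmv := hmax v' hv'
  have hLyx := hA.Lyx_pos
  have hLxx := hA.Lxx_nonneg
  simp only [regPayoff] at hmv hprog hgr hgr' ⊢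
  set N := ‖x' - x‖ with hNd
  have hN0 : 0 ≤ N := norm_nonneg _
  have e1 : Lyx * ‖v' - v‖ * N ≤ Lyx ^ 2 / m * N ^ 2 := by
    have : ‖v' - v‖ ≤ Lyx * N / m := by rw [le_div_iff₀ hm0]; linarith
    calc Lyx * ‖v' - v‖ * N ≤ Lyx * (Lyx * N / m) * N := by gcongr
      _ = _ := by ring
  -- Each cross term takes `N² / (8 τ)`; `r` is then traded for the gap through quadratic growth.
  have young : ∀ r h : ℝ, 0 ≤ r → m / 2 * r ^ 2 ≤ h →
      Lyx * r * N ≤ N ^ 2 / (8 * τ) + 4 * Lyx ^ 2 * (τ * h / m) := by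
    intro r h hr hrh
    have h1 : Lyx * r * N ≤ N ^ 2 / (8 * τ) + 2 * τ * (Lyx * r) ^ 2 := by
      have : 0 ≤ (N - 4 * τ * (Lyx * r)) ^ 2 / (8 * τ) := by positivity
      have h2 : (N - 4 * τ * (Lyx * r)) ^ 2 / (8 * τ) =
        N ^ 2 / (8 * τ) + 2 * τ * (Lyx * r) ^ 2 - Lyx * r * N := by field_simp; ring
      linarith
    have h3 : r ^ 2 ≤ 2 * h / m := by rw [le_div_iff₀ hm0]; linarith
    have h4 : 2 * τ * (Lyx * r) ^ 2 ≤ 4 * Lyx ^ 2 * (τ * h / m) := by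
      calc 2 * τ * (Lyx * r) ^ 2 = 2 * τ * Lyx ^ 2 * r ^ 2 := by ring
        _ ≤ 2 * τ * Lyx ^ 2 * (2 * h / m) := by gcongr
        _ = _ := by ring
    linarith
  have y1 := young _ _ (norm_nonneg (y - v)) hgr
  -- Since `p ≥ 0`, the gap at `y'` is at most the gap at `y`, so both cross terms are charged to
  -- the same quantity.
  have y2 := young _ _ (norm_nonneg (y' - v)) (hgr'.trans (b := _) (sub_le_sub_left
    (le_trans (le_add_of_nonneg_right hp) hprog) _))
  set Q := Lxx + Lyx ^ 2 / m with hQ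
  have hQ0 : 0 ≤ Q := by positivity
  have hM0 : 0 ≤ M := (norm_nonneg _).trans hM
  -- For `8 Q τ ≤ 1` the curvature term is absorbed; otherwise `N ≤ τ M` and an extra factor `8 Q τ
  -- ≥ 1` make it an `O(τ³)` error.
  have e2 : Q * N ^ 2 ≤ N ^ 2 / (8 * τ) + 8 * Q ^ 2 * M ^ 2 * τ ^ 3 := by
    rcases le_total (8 * Q * τ) 1 with h | h
    · have : Q * N ^ 2 ≤ N ^ 2 / (8 * τ) := by
        rw [le_div_iff₀ (by positivity)]; nlinarith [sq_nonneg N]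
      have : 0 ≤ 8 * Q ^ 2 * M ^ 2 * τ ^ 3 := by positivity
      linarith
    · have h1 : N ≤ τ * M := hN.trans (by gcongr)
      have h2 : Q * N ^ 2 ≤ Q * (τ * M) ^ 2 := by gcongr
      have h3 : Q * (τ * M) ^ 2 * 1 ≤ Q * (τ * M) ^ 2 * (8 * Q * τ) := by gcongr
      have h4 : Q * (τ * M) ^ 2 * (8 * Q * τ) = 8 * Q ^ 2 * M ^ 2 * τ ^ 3 := by ring
      have : 0 ≤ N ^ 2 / (8 * τ) := by positivity
      linarith
  have e3 : N ^ 2 / τ ≤ -⟪gradX L x y, x' - x⟫ := by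
    rw [div_le_iff₀ hτ]; linarith
  have e4 : N ^ 2 / (8 * τ) = N ^ 2 / τ / 8 := by field_simp
  have e5 : N ^ 2 / (2 * τ) = N ^ 2 / τ / 2 := by field_simp
  have e6 : Q * N ^ 2 = Lxx * N ^ 2 + Lyx ^ 2 / m * N ^ 2 := by rw [hQ]; ring
  rw [e4] at y1 y2 e2
  have e7 : 0 ≤ Lxx * N ^ 2 := by positivity
  rw [e5]
  linarith

theorem StandingAssumption.dualGap_nonneg (hA : StandingAssumption X Y L μ Lxx Lyx Lyy)
    (y₀ : Euc ny) (β : ℝ) {x : Euc nx} {y : Euc ny} (hx : x ∈ X) (hy : y ∈ Y) :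
    0 ≤ dualGap Y (regPayoff L y₀ β) x y := by
  obtain ⟨v, hv, hmax, hS⟩ := hA.exists_maximizer y₀ β ⟨y, hy⟩ hx
  simp only [dualGap, hS]
  exact sub_nonneg.2 (hmax y hy)

/-- Lowering `β` raises `2 Φ_β` by at most `(β - β') D²`, while the change of `-L_β(x, y)` is
nonpositive; the added `D² β` compensates exactly. -/
theorem StandingAssumption.potential_antitone (hA : StandingAssumption X Y L μ Lxx Lyx Lyy)
    {y₀ : Euc ny} {β β' D : ℝ} (hβ : β' ≤ β) (hD : ∀ w ∈ Y, ‖w - y₀‖ ≤ D) {x : Euc nx}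
    {y : Euc ny} (hx : x ∈ X) (hy : y ∈ Y) :
    potential Y L y₀ β' x y + D ^ 2 * β' ≤ potential Y L y₀ β x y + D ^ 2 * β := by
  obtain ⟨v, hv, hmax, hS⟩ := hA.exists_maximizer y₀ β ⟨y, hy⟩ hx
  obtain ⟨v', hv', hmax', hS'⟩ := hA.exists_maximizer y₀ β' ⟨y, hy⟩ hx
  simp only [potential, dualGap, hS, hS']
  have h1 := hmax v' hv'
  simp only [regPayoff] at h1 ⊢
  have h2 : ‖v' - y₀‖ ^ 2 ≤ D ^ 2 := by gcongr; exact hD _ hv'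
  have h3 : 0 ≤ (β - β') * (D ^ 2 - ‖v' - y₀‖ ^ 2) :=
    mul_nonneg (by linarith) (by linarith)
  have h4 : 0 ≤ (β - β') * ‖y - y₀‖ ^ 2 := mul_nonneg (by linarith) (by positivity)
  nlinarith

theorem StandingAssumption.dualGap_le_dualGap_regPayoff
    (hA : StandingAssumption X Y L μ Lxx Lyx Lyy) {y₀ : Euc ny} {β D : ℝ} (hβ : 0 ≤ β)
    (hD : ∀ w ∈ Y, ‖w - y₀‖ ≤ D) {x : Euc nx} {y : Euc ny} (hx : x ∈ X) (hy : y ∈ Y) :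
    dualGap Y L x y ≤ dualGap Y (regPayoff L y₀ β) x y + D ^ 2 * β := by
  obtain ⟨v, hv, hmax, hS⟩ := hA.exists_maximizer y₀ β ⟨y, hy⟩ hx
  obtain ⟨v', hv', hmax', hS'⟩ := hA.exists_maximizer y₀ 0 ⟨y, hy⟩ hx
  have h0 : regPayoff L y₀ 0 x = L x := by ext; simp [regPayoff]
  rw [h0] at hS'
  have h1 := hmax v' hv'
  simp only [dualGap, hS]
  rw [hS']
  simp only [regPayoff] at h1 ⊢
  have h2 : ‖v' - y₀‖ ^ 2 ≤ D ^ 2 := by gcongr; exact hD _ hv'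
  have h3 : 0 ≤ β * (D ^ 2 - ‖v' - y₀‖ ^ 2) := mul_nonneg hβ (by linarith)
  have h4 : 0 ≤ β * ‖y - y₀‖ ^ 2 := by positivity
  have h5 : 0 ≤ β * D ^ 2 := by positivity
  nlinarith

theorem StandingAssumption.exists_bounds (hA : StandingAssumption X Y L μ Lxx Lyx Lyy) :
    ∃ M D B : ℝ, 0 < D ∧ 0 < B ∧ (∀ x ∈ X, ∀ y ∈ Y, ‖gradX L x y‖ ≤ M) ∧
      (∀ y ∈ Y, ∀ y' ∈ Y, ‖y - y'‖ ≤ D) ∧ ∀ x ∈ X, ∀ y ∈ Y, |L x y| ≤ B := by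
  obtain ⟨B, hB⟩ := (hA.compactX.prod hA.compactY).exists_bound_of_continuousOn
    (f := fun p : Euc nx × Euc ny => L p.1 p.2)
    (fun p hp => (hA.differentiableAt_uncurry hp.1 hp.2).continuousAt.continuousWithinAt)
  obtain ⟨D₁, hD₁⟩ := Metric.isBounded_iff.1 hA.compactX.isBounded
  obtain ⟨D₂, hD₂⟩ := Metric.isBounded_iff.1 hA.compactY.isBounded
  simp only [dist_eq_norm] at hD₁ hD₂
  have hM : ∃ M : ℝ, ∀ x ∈ X, ∀ y ∈ Y, ‖gradX L x y‖ ≤ M := by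
    by_cases hne : X.Nonempty ∧ Y.Nonempty
    · obtain ⟨⟨x₁, hx₁⟩, y₁, hy₁⟩ := hne
      refine ⟨Lxx * D₁ + Lyx * D₂ + ‖gradX L x₁ y₁‖, fun x hx y hy => ?_⟩
      have h1 := hA.lipschitzX x hx y hy x₁ hx₁ y₁ hy₁
      have h2 := norm_sub_norm_le (gradX L x y) (gradX L x₁ y₁)
      have h3 : Lxx * ‖x - x₁‖ ≤ Lxx * D₁ :=
        mul_le_mul_of_nonneg_left (hD₁ hx hx₁) hA.Lxx_nonneg
      have h4 : Lyx * ‖y - y₁‖ ≤ Lyx * D₂ :=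
        mul_le_mul_of_nonneg_left (hD₂ hy hy₁) hA.Lyx_pos.le
      linarith
    · exact ⟨0, fun x hx y hy => absurd ⟨⟨x, hx⟩, y, hy⟩ hne⟩
  obtain ⟨M, hM⟩ := hM
  exact ⟨M, max D₂ 1, max B 1, by positivity, by positivity, hM,
    fun y hy y' hy' => (hD₂ hy hy').trans (le_max_left _ _),
    fun x hx y hy => (hB (x, y) ⟨hx, hy⟩).trans (le_max_left _ _)⟩

end POLMO

/-! ### Power sums and weighted descent -/

namespace POLMO

section Sequences

theorem sum_rpow_neg_le {s : ℝ} (hs0 : 0 ≤ s) (hs1 : s < 1) (n : ℕ) :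
    ∑ t ∈ Finset.range n, ((t : ℝ) + 1) ^ (-s) ≤ (1 - s)⁻¹ * (n : ℝ) ^ (1 - s) := by
  have h1s : 0 < 1 - s := by linarith
  induction n with
  | zero => simp [Real.zero_rpow h1s.ne']
  | succ n ih =>
    rw [Finset.sum_range_succ]
    push_cast
    have hn : (0 : ℝ) < (n : ℝ) + 1 := by positivity
    suffices h : (1 - s) * ((n : ℝ) + 1) ^ (-s) ≤ ((n : ℝ) + 1) ^ (1 - s) - (n : ℝ) ^ (1 - s) by
      have h2 : ((n : ℝ) + 1) ^ (-s) ≤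
          (1 - s)⁻¹ * (((n : ℝ) + 1) ^ (1 - s) - (n : ℝ) ^ (1 - s)) := by
        rw [← div_eq_inv_mul, le_div_iff₀ h1s]; linarith
      linarith
    have hx : (-1 : ℝ) ≤ -(1 / ((n : ℝ) + 1)) := by
      rw [neg_le_neg_iff, div_le_one hn]; linarith [(Nat.cast_nonneg n : (0 : ℝ) ≤ n)]
    -- Bernoulli's inequality for the exponent `1 - s ≤ 1` makes the sum telescope.
    have hb := rpow_one_add_le_one_add_mul_self hx h1s.le (by linarith)
    have hfac : (n : ℝ) = ((n : ℝ) + 1) * (1 + -(1 / ((n : ℝ) + 1))) := by field_simp; ring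
    have h3 : (n : ℝ) ^ (1 - s) ≤
        ((n : ℝ) + 1) ^ (1 - s) * (1 + (1 - s) * -(1 / ((n : ℝ) + 1))) := by
      conv_lhs => rw [hfac]
      rw [Real.mul_rpow hn.le (by linarith)]
      gcongr
    have h4 : ((n : ℝ) + 1) ^ (1 - s) = ((n : ℝ) + 1) ^ (-s) * ((n : ℝ) + 1) := by
      rw [show 1 - s = -s + 1 by ring, Real.rpow_add_one hn.ne']
    have h5 : ((n : ℝ) + 1) ^ (-s) * ((n : ℝ) + 1) * (1 + (1 - s) * -(1 / ((n : ℝ) + 1))) =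
        ((n : ℝ) + 1) ^ (-s) * ((n : ℝ) + 1) - (1 - s) * ((n : ℝ) + 1) ^ (-s) := by
      field_simp
      ring
    rw [h4, h5] at h3
    rw [h4]
    linarith

theorem sum_rpow_le {s : ℝ} (hs0 : 0 ≤ s) (T : ℕ) :
    ∑ t ∈ Finset.range (T + 1), ((t : ℝ) + 1) ^ s ≤ ((T : ℝ) + 1) ^ (1 + s) := by
  have hT : (0 : ℝ) < (T : ℝ) + 1 := by positivity
  calc ∑ t ∈ Finset.range (T + 1), ((t : ℝ) + 1) ^ s
      ≤ ∑ _t ∈ Finset.range (T + 1), ((T : ℝ) + 1) ^ s := by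
        refine Finset.sum_le_sum fun t ht => ?_
        have : (t : ℝ) ≤ T := by exact_mod_cast Nat.lt_succ_iff.1 (Finset.mem_range.1 ht)
        gcongr
    _ = ((T : ℝ) + 1) ^ (1 + s) := by
        rw [Finset.sum_const, Finset.card_range, nsmul_eq_mul, Real.rpow_add hT, Real.rpow_one]
        push_cast
        ring

theorem sum_mul_sub_succ_le {w V : ℕ → ℝ} {B : ℝ} (hw : Monotone w) (hw0 : 0 ≤ w 0)
    (hV : ∀ t, V t ≤ B) (n : ℕ) :
    ∑ t ∈ Finset.range (n + 1), w t * (V t - V (t + 1)) ≤ w n * (B - V (n + 1)) := by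
  induction n with
  | zero => simpa using mul_le_mul_of_nonneg_left (sub_le_sub_right (hV 0) _) hw0
  | succ n ih =>
    rw [Finset.sum_range_succ]
    have h1 : w n * (B - V (n + 1)) ≤ w (n + 1) * (B - V (n + 1)) :=
      mul_le_mul_of_nonneg_right (hw n.le_succ) (sub_nonneg.2 (hV _))
    linarith

/-- A bounded Lyapunov sequence controls the weighted sum of its decrements. -/
theorem weighted_sum_le_of_descent {a V : ℕ → ℝ} {B₁ B₂ K : ℝ} (hK : 0 ≤ K)
    (hV₁ : ∀ t, B₁ ≤ V t) (hV₂ : ∀ t, V t ≤ B₂)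
    (h : ∀ t : ℕ, V (t + 1) + a t ≤ V t + K / ((t : ℝ) + 1)) (T : ℕ) :
    ∑ t ∈ Finset.range (T + 1), ((t : ℝ) + 1) ^ (1 / 4 : ℝ) * a t ≤
      (B₂ - B₁ + 4 * K) * ((T : ℝ) + 1) ^ (1 / 4 : ℝ) := by
  have hmono : Monotone fun t : ℕ => ((t : ℝ) + 1) ^ (1 / 4 : ℝ) := fun s t hst => by
    have : (s : ℝ) ≤ t := by exact_mod_cast hst
    dsimp only
    gcongr
  have h1 := sum_mul_sub_succ_le hmono (by positivity) hV₂ T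
  -- The weighted errors are `(t + 1)^(1/4) / (t + 1) = (t + 1)^(-3/4)`, and their sum has the order
  -- of the last weight.
  have h2 := sum_rpow_neg_le (s := 3 / 4) (by norm_num) (by norm_num) (T + 1)
  norm_num at h2
  calc ∑ t ∈ Finset.range (T + 1), ((t : ℝ) + 1) ^ (1 / 4 : ℝ) * a t
      ≤ ∑ t ∈ Finset.range (T + 1), (((t : ℝ) + 1) ^ (1 / 4 : ℝ) * (V t - V (t + 1)) +
          K * ((t : ℝ) + 1) ^ (-(3 / 4) : ℝ)) := by
        refine Finset.sum_le_sum fun t _ => ?_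
        have ht : (0 : ℝ) < (t : ℝ) + 1 := by positivity
        have h3 : ((t : ℝ) + 1) ^ (-(3 / 4) : ℝ) = ((t : ℝ) + 1) ^ (1 / 4 : ℝ) / ((t : ℝ) + 1) := by
          rw [← Real.rpow_sub_one ht.ne']; norm_num
        calc ((t : ℝ) + 1) ^ (1 / 4 : ℝ) * a t
            ≤ ((t : ℝ) + 1) ^ (1 / 4 : ℝ) * (V t - V (t + 1) + K / ((t : ℝ) + 1)) := by
              gcongr; linarith [h t]
          _ = _ := by rw [h3]; ring
    _ ≤ ((T : ℝ) + 1) ^ (1 / 4 : ℝ) * (B₂ - V (T + 1)) +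
          K * (4 * ((T : ℝ) + 1) ^ (1 / 4 : ℝ)) := by
        rw [Finset.sum_add_distrib, ← Finset.mul_sum]
        gcongr
    _ ≤ ((T : ℝ) + 1) ^ (1 / 4 : ℝ) * (B₂ - B₁) + K * (4 * ((T : ℝ) + 1) ^ (1 / 4 : ℝ)) := by
        gcongr
        exact hV₁ _
    _ = _ := by ring

theorem isTheta_rpow_succ {a : ℝ} (ha : 0 ≤ a) :
    (fun t : ℕ => (t : ℝ) ^ (-a)) =Θ[atTop] fun t : ℕ => ((t : ℝ) + 1) ^ (-a) := by
  have h : (fun t : ℕ => (t : ℝ) ^ a) =Θ[atTop] fun t : ℕ => ((t : ℝ) + 1) ^ a := by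
    refine ⟨IsBigO.of_bound 1 (Eventually.of_forall fun t => ?_),
      IsBigO.of_bound (2 ^ a) ((eventually_ge_atTop 1).mono fun t ht => ?_)⟩
    · rw [one_mul, Real.norm_of_nonneg (by positivity), Real.norm_of_nonneg (by positivity)]
      gcongr
      linarith
    · have ht' : (1 : ℝ) ≤ t := by exact_mod_cast ht
      rw [Real.norm_of_nonneg (by positivity), Real.norm_of_nonneg (by positivity),
        ← Real.mul_rpow (by norm_num) (by positivity)]
      gcongr
      linarith
  have h2 := h.inv
  refine (IsTheta.of_norm_eventuallyEq_norm (Eventually.of_forall fun t => ?_)).trans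
    (h2.trans (IsTheta.of_norm_eventuallyEq_norm (Eventually.of_forall fun t => ?_)))
  · dsimp only; rw [Real.rpow_neg (by positivity)]
  · dsimp only; rw [Real.rpow_neg (by positivity)]

/-- Positivity extends the asymptotic comparison to all `t`. The shift to `t + 1` avoids the base
`0` at the initial step. -/
theorem exists_rpow_bounds {a : ℝ} (ha : 0 ≤ a) {τ : ℕ → ℝ} (hpos : ∀ t, 0 < τ t)
    (h : τ =Θ[atTop] fun t : ℕ => (t : ℝ) ^ (-a)) :
    ∃ c C : ℝ, 0 < c ∧ 0 < C ∧ ∀ t : ℕ, c * ((t : ℝ) + 1) ^ (-a) ≤ τ t ∧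
      τ t ≤ C * ((t : ℝ) + 1) ^ (-a) := by
  have h1 := h.trans (isTheta_rpow_succ ha)
  have hp : ∀ t : ℕ, (0 : ℝ) < ((t : ℝ) + 1) ^ (-a) := fun t => by positivity
  obtain ⟨C, hC⟩ := (isBigO_nat_atTop_iff fun t ht => absurd ht (hp t).ne').1 h1.1
  obtain ⟨c, hc⟩ := (isBigO_nat_atTop_iff fun t ht => absurd ht (hpos t).ne').1 h1.2
  have hC' : ∀ t, τ t ≤ C * ((t : ℝ) + 1) ^ (-a) := fun t => by
    simpa [abs_of_pos (hpos t), abs_of_pos (hp t)] using hC t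
  have hc' : ∀ t : ℕ, ((t : ℝ) + 1) ^ (-a) ≤ c * τ t := fun t => by
    simpa [abs_of_pos (hpos t), abs_of_pos (hp t)] using hc t
  have hc0 : 0 < c := pos_of_mul_pos_left ((hp 0).trans_le (hc' 0)) (hpos 0).le
  refine ⟨c⁻¹, C, inv_pos.2 hc0, pos_of_mul_pos_left ((hpos 0).trans_le (hC' 0)) (hp 0).le,
    fun t => ⟨?_, hC' t⟩⟩
  rw [inv_mul_le_iff₀ hc0]
  exact hc' t

/-- A nonincreasing nonnegative sequence that vanishes once vanishes from then on, against the lower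
asymptotic bound. Positivity allows `β_t` itself to serve as the modulus `m_t`. -/
theorem IsSmoothing.pos {b : ℝ} {β : ℕ → ℝ} (h : IsSmoothing b β) (t : ℕ) : 0 < β t := by
  refine lt_of_le_of_ne (h.1 t) fun h0 => ?_
  obtain ⟨c, hc⟩ := h.2.2.2.bound
  obtain ⟨s, hs⟩ := (hc.and ((eventually_ge_atTop t).and (eventually_ge_atTop 1))).exists
  have hz : β s = 0 := le_antisymm (h0 ▸ h.2.1 hs.2.1) (h.1 s)
  have hs1 : (0 : ℝ) < s := by exact_mod_cast hs.2.2
  have h1 := hs.1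
  rw [hz, norm_zero, mul_zero, norm_le_zero_iff] at h1
  exact (Real.rpow_pos_of_pos hs1 _).ne' h1

theorem pow_div_pow_le_div {τ m : ℕ → ℝ} {C c e b : ℝ} (hc : 0 < c) (hτ0 : ∀ t, 0 < τ t)
    (hτ : ∀ t : ℕ, τ t ≤ C * ((t : ℝ) + 1) ^ (-e)) (hm : ∀ t : ℕ, c * ((t : ℝ) + 1) ^ (-b) ≤ m t)
    {i j : ℕ} (hij : 1 ≤ i * e - j * b) (t : ℕ) :
    τ t ^ i / m t ^ j ≤ C ^ i / c ^ j / ((t : ℝ) + 1) := by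
  have ht : (0 : ℝ) < (t : ℝ) + 1 := by positivity
  have ht1 : (1 : ℝ) ≤ (t : ℝ) + 1 := by linarith [(Nat.cast_nonneg t : (0 : ℝ) ≤ t)]
  have hp : ∀ s : ℝ, 0 < ((t : ℝ) + 1) ^ s := fun s => Real.rpow_pos_of_pos ht s
  have hC : 0 < C := pos_of_mul_pos_left ((hτ0 t).trans_le (hτ t)) (hp _).le
  calc τ t ^ i / m t ^ j
      ≤ (C * ((t : ℝ) + 1) ^ (-e)) ^ i / (c * ((t : ℝ) + 1) ^ (-b)) ^ j := by
        have := hτ0 t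
        have := hp (-b)
        gcongr
        exacts [hτ t, hm t]
    _ = C ^ i / c ^ j * ((t : ℝ) + 1) ^ (-(i * e - j * b)) := by
        rw [mul_pow, mul_pow, ← Real.rpow_mul_natCast ht.le, ← Real.rpow_mul_natCast ht.le,
          mul_div_mul_comm, ← Real.rpow_sub ht]
        congr 2
        ring
    _ ≤ C ^ i / c ^ j * ((t : ℝ) + 1) ^ (-1 : ℝ) := by
        gcongr
    _ = _ := by rw [Real.rpow_neg_one, div_eq_mul_inv _ ((t : ℝ) + 1)]

theorem runAvg_le {g : ℕ → ℝ} {K r : ℝ} (hK : 0 ≤ K) (hr : 0 ≤ r) {T : ℕ} (hT : 1 ≤ T)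
    (h : ∑ t ∈ Finset.range (T + 1), g t ≤ K * ((T : ℝ) + 1) ^ (1 - r)) :
    runAvg g T ≤ K * (T : ℝ) ^ (-r) := by
  have hn : (0 : ℝ) < (T : ℝ) + 1 := by positivity
  have hT0 : (0 : ℝ) < T := by exact_mod_cast hT
  calc runAvg g T ≤ 1 / ((T : ℝ) + 1) * (K * ((T : ℝ) + 1) ^ (1 - r)) := by
        unfold runAvg; gcongr
    _ = K * ((T : ℝ) + 1) ^ (-r) := by
        rw [show 1 - r = -r + 1 by ring, Real.rpow_add_one hn.ne']; field_simp
    _ ≤ K * (T : ℝ) ^ (-r) := by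
        refine mul_le_mul_of_nonneg_left ?_ hK
        exact Real.rpow_le_rpow_of_nonpos hT0 (by linarith) (by linarith)

end Sequences

theorem HasRate.hasRateLog {nx ny : ℕ} {R : (ℕ → Euc nx) → (ℕ → Euc ny) → Prop}
    {g : (ℕ → Euc nx) → (ℕ → Euc ny) → ℕ → ℝ} {r : ℝ} (h : HasRate R g r) : HasRateLog R g r := by
  obtain ⟨K, hK⟩ := h
  exact ⟨K, 0, fun x y hR T hT => by simpa using hK x y hR T hT⟩

end POLMO

/-! ### From descent along a run to averaged gaps -/

namespace POLMO

variable {nx ny : ℕ} {X : Set (Euc nx)} {Y : Set (Euc ny)} {L : Euc nx → Euc ny → ℝ}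
  {μ Lxx Lyx Lyy : ℝ}

theorem IsLMO.inner_le {n : ℕ} {C : Set (Euc n)} {d v : Euc n} (h : IsLMO C (-d) v) :
    ∀ w ∈ C, ⟪d, w⟫ ≤ ⟪d, v⟫ := by
  intro w hw
  have := h.2 w hw
  rw [inner_neg_left, inner_neg_left] at this
  linarith

theorem IsPOLMOSequence.mem (hA : StandingAssumption X Y L μ Lxx Lyx Lyy) {τ β m : ℕ → ℝ}
    (hβ : ∀ t, 0 ≤ β t) (hm0 : ∀ t, 0 < m t) (hm : ∀ t, m t ≤ μ + β t)
    {x : ℕ → Euc nx} {y : ℕ → Euc ny} (hR : IsPOLMOSequence X Y L Lyy τ β x y) (t : ℕ) :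
    x t ∈ X ∧ y t ∈ Y := by
  obtain ⟨hx0, hy0, u, hu⟩ := hR
  induction t with
  | zero => exact ⟨hx0, hy0⟩
  | succ t ih =>
    obtain ⟨h1, h2, h3⟩ := hu t
    refine ⟨h1 ▸ (PO_spec hA.compactX ⟨_, hx0⟩ _).1, ?_⟩
    exact (frankWolfe_progress (hm0 t) (hA.strongConcaveOn_regPayoff (y 0) (hm t) ih.1)
      (fun z hz => (hA.hasGradientAt_regPayoff (y 0) (β t) ih.1 hz).1)
      (fun z hz z' hz' => hA.lipschitz_gradY_regPayoff (y 0) (hβ t) ih.1 hz hz')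
      (add_nonneg hA.Lyy_nonneg (hβ t)) ih.2 h2.1 h2.inner_le h3).1

theorem StandingAssumption.dualGap_regPayoff_le (hA : StandingAssumption X Y L μ Lxx Lyx Lyy)
    {y₀ : Euc ny} {β D B : ℝ} (hβ : 0 ≤ β) (hD : ∀ w ∈ Y, ‖w - y₀‖ ≤ D)
    (hB : ∀ x ∈ X, ∀ y ∈ Y, |L x y| ≤ B) {x : Euc nx} {y : Euc ny} (hx : x ∈ X) (hy : y ∈ Y) :
    dualGap Y (regPayoff L y₀ β) x y ≤ 2 * B + D ^ 2 * β := by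
  obtain ⟨v, hv, hmax, hS⟩ := hA.exists_maximizer y₀ β ⟨y, hy⟩ hx
  simp only [dualGap, hS]
  simp only [regPayoff]
  have h1 := abs_le.1 (hB x hx v hv)
  have h2 := abs_le.1 (hB x hx y hy)
  have h3 : β * ‖y - y₀‖ ^ 2 ≤ β * D ^ 2 := by gcongr; exact hD y hy
  have h4 : 0 ≤ β * ‖v - y₀‖ ^ 2 := by positivity
  have h5 : 0 ≤ β * ‖y - y₀‖ ^ 2 := by positivity
  linarith

theorem StandingAssumption.potential_bounds (hA : StandingAssumption X Y L μ Lxx Lyx Lyy)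
    {y₀ : Euc ny} {β D B : ℝ} (hβ : 0 ≤ β) (hD : ∀ w ∈ Y, ‖w - y₀‖ ≤ D)
    (hB : ∀ x ∈ X, ∀ y ∈ Y, |L x y| ≤ B) {x : Euc nx} {y : Euc ny} (hx : x ∈ X) (hy : y ∈ Y) :
    -B ≤ potential Y L y₀ β x y + D ^ 2 * β ∧
      potential Y L y₀ β x y + D ^ 2 * β ≤ 3 * B + 2 * (D ^ 2 * β) := by
  obtain ⟨v, hv, hmax, hS⟩ := hA.exists_maximizer y₀ β ⟨y, hy⟩ hx
  have h0 := hA.dualGap_nonneg y₀ β hx hy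
  have h1 := hA.dualGap_regPayoff_le hβ hD hB hx hy
  have h2 := abs_le.1 (hB x hx v hv)
  have h3 : β * ‖v - y₀‖ ^ 2 ≤ β * D ^ 2 := by gcongr; exact hD v hv
  have h4 : 0 ≤ β * ‖v - y₀‖ ^ 2 := by positivity
  simp only [potential, hS]
  simp only [regPayoff] at h0 h1 ⊢
  constructor <;> linarith

/-- The smoothed dual gap along a run. -/
noncomputable def smoothedGap (Y : Set (Euc ny)) (L : Euc nx → Euc ny → ℝ) (β : ℕ → ℝ) (x : ℕ → Euc nx)
    (y : ℕ → Euc ny) (t : ℕ) : ℝ :=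
  dualGap Y (regPayoff L (y 0) (β t)) (x t) (y t)

/-- Common to both geometries: `P` is the Frank-Wolfe progress as a function of the gap, and half of
it is spent on the cross term. The constant uses only bounds over all of `X` and `Y`, hence is
uniform over runs. -/
theorem StandingAssumption.sum_progress_le (hA : StandingAssumption X Y L μ Lxx Lyx Lyy)
    {τ β m : ℕ → ℝ} {m₀ K₁ K₂ : ℝ} {P : ℕ → ℝ → ℝ} (hτ : ∀ t, 0 < τ t) (hβ : ∀ t, 0 ≤ β t)
    (hβa : Antitone β) (hm0 : ∀ t, 0 < m t) (hm : ∀ t, m t ≤ μ + β t) (hmm : ∀ t, m t ≤ m₀)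
    (hP : ∀ t h, 0 ≤ h → 0 ≤ P t h)
    (hprog : ∀ x y, IsPOLMOSequence X Y L Lyy τ β x y → ∀ t,
      regPayoff L (y 0) (β t) (x t) (y t) + P t (smoothedGap Y L β x y t) ≤
        regPayoff L (y 0) (β t) (x t) (y (t + 1)))
    (hyoung : ∀ t h, 0 ≤ h → 8 * Lyx ^ 2 * (τ t * h / m t) ≤ P t h / 2 + K₁ / ((t : ℝ) + 1))
    (hcube : ∀ t, τ t ^ 3 / m t ^ 2 ≤ K₂ / ((t : ℝ) + 1)) :
    ∃ K : ℝ, 0 ≤ K ∧ ∀ x y, IsPOLMOSequence X Y L Lyy τ β x y → ∀ T : ℕ,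
      ∑ t ∈ Finset.range (T + 1), ((t : ℝ) + 1) ^ (1 / 4 : ℝ) *
        (P t (smoothedGap Y L β x y t) / 2 + ‖x (t + 1) - x t‖ ^ 2 / (2 * τ t)) ≤
          K * ((T : ℝ) + 1) ^ (1 / 4 : ℝ) := by
  obtain ⟨M, D, B, hD0, hB0, hM, hD, hB⟩ := hA.exists_bounds
  set K := |K₁| + 16 * (Lxx * m₀ + Lyx ^ 2) ^ 2 * M ^ 2 * |K₂| with hK
  have hK0 : 0 ≤ K := by positivity
  refine ⟨3 * B + 2 * (D ^ 2 * β 0) - -B + 4 * K, ?_, fun x y hR T => ?_⟩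
  · have := hβ 0
    have : 0 ≤ 2 * (D ^ 2 * β 0) := by positivity
    linarith
  have hmem := fun t => hR.mem hA hβ hm0 hm t
  have hDy : ∀ w ∈ Y, ‖w - y 0‖ ≤ D := fun w hw => hD w hw _ (hmem 0).2
  refine weighted_sum_le_of_descent
    (V := fun t => potential Y L (y 0) (β t) (x t) (y t) + D ^ 2 * β t) hK0
    (fun t => (hA.potential_bounds (hβ t) hDy hB (hmem t).1 (hmem t).2).1)
    (fun t => (hA.potential_bounds (hβ t) hDy hB (hmem t).1 (hmem t).2).2.trans ?_)
    (fun t => ?_) T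
  · have := hβa (Nat.zero_le t)
    gcongr
  have hx1 : x (t + 1) = PO X (x t - τ t • gradX L (x t) (y t)) := by
    obtain ⟨-, -, u, hu⟩ := hR
    exact (hu t).1
  have hh0 : 0 ≤ smoothedGap Y L β x y t :=
    hA.dualGap_nonneg (y 0) (β t) (hmem t).1 (hmem t).2
  have hstep := hA.potential_step (hm0 t) (hm t) (hmem t).1 (hmem t).2 (hmem (t + 1)).2 (hτ t)
    (hM _ (hmem t).1 _ (hmem t).2) (hP t _ hh0) (hprog x y hR t)
  rw [← hx1] at hstep
  have hanti := hA.potential_antitone (hβa t.le_succ) hDy (hmem (t + 1)).1 (hmem (t + 1)).2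
  have hy := hyoung t _ hh0
  have ht : (0 : ℝ) < (t : ℝ) + 1 := by positivity
  have hLxx := hA.Lxx_nonneg
  have hLyx := hA.Lyx_pos
  have hmt := hm0 t
  have hτt := hτ t
  have hc : 16 * (Lxx + Lyx ^ 2 / m t) ^ 2 * M ^ 2 * τ t ^ 3 ≤
      16 * (Lxx * m₀ + Lyx ^ 2) ^ 2 * M ^ 2 * |K₂| / ((t : ℝ) + 1) := by
    calc 16 * (Lxx + Lyx ^ 2 / m t) ^ 2 * M ^ 2 * τ t ^ 3
        = 16 * (Lxx * m t + Lyx ^ 2) ^ 2 * M ^ 2 * (τ t ^ 3 / m t ^ 2) := by field_simp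
      _ ≤ 16 * (Lxx * m₀ + Lyx ^ 2) ^ 2 * M ^ 2 * (|K₂| / ((t : ℝ) + 1)) := by
          have h1 : τ t ^ 3 / m t ^ 2 ≤ |K₂| / ((t : ℝ) + 1) :=
            (hcube t).trans (by gcongr; exact le_abs_self _)
          have := hmm t
          gcongr
      _ = _ := by ring
  have hK1 : K₁ / ((t : ℝ) + 1) ≤ |K₁| / ((t : ℝ) + 1) := by gcongr; exact le_abs_self _
  have hKd : K / ((t : ℝ) + 1) = |K₁| / ((t : ℝ) + 1) +
      16 * (Lxx * m₀ + Lyx ^ 2) ^ 2 * M ^ 2 * |K₂| / ((t : ℝ) + 1) := by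
    rw [hK]; ring
  rw [hKd]
  simp only [smoothedGap] at *
  linarith

/-- From a weighted bound on the squared steps to the average gradient mapping. -/
theorem StandingAssumption.avgProjGap_rate (hA : StandingAssumption X Y L μ Lxx Lyx Lyy)
    {τ β m : ℕ → ℝ} {c C e K : ℝ} (hc : 0 < c) (hτ : ∀ t, 0 < τ t)
    (he0 : 1 / 4 ≤ e) (he1 : e ≤ 1)
    (hτl : ∀ t : ℕ, c * ((t : ℝ) + 1) ^ (-e) ≤ τ t)
    (hτu : ∀ t : ℕ, τ t ≤ C * ((t : ℝ) + 1) ^ (-e)) (hβ : ∀ t, 0 ≤ β t)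
    (hm0 : ∀ t, 0 < m t) (hm : ∀ t, m t ≤ μ + β t) (hK : 0 ≤ K)
    (hsum : ∀ x y, IsPOLMOSequence X Y L Lyy τ β x y → ∀ T : ℕ,
      ∑ t ∈ Finset.range (T + 1), ((t : ℝ) + 1) ^ (1 / 4 : ℝ) *
        (‖x (t + 1) - x t‖ ^ 2 / (2 * τ t)) ≤ K * ((T : ℝ) + 1) ^ (1 / 4 : ℝ)) :
    HasRate (IsPOLMOSequence X Y L Lyy τ β) (avgProjGap X L (τ 0)) ((1 - e) / 2) := by
  have hC : 0 < C := pos_of_mul_pos_left ((hτ 0).trans_le (hτu 0)) (by positivity)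
  have hτC : ∀ t, τ t ≤ C := fun t => (hτu t).trans (by
    refine mul_le_of_le_one_right hC.le (Real.rpow_le_one_of_one_le_of_nonpos ?_ (by linarith))
    linarith [(Nat.cast_nonneg t : (0 : ℝ) ≤ t)])
  set Γ := max 1 (C / τ 0) with hΓ
  have hΓ0 : 0 < Γ := by positivity
  refine ⟨Γ * (K + c⁻¹), fun x y hR T hT => ?_⟩
  refine runAvg_le (by positivity) (by linarith) hT ?_
  have hmem := fun t => hR.mem hA hβ hm0 hm t
  have hn : (0 : ℝ) < (T : ℝ) + 1 := by positivity
  -- The Young parameter is chosen so that `s (T + 1)^(1/4)` and `s⁻¹ (T + 1)^(3/4 + e)` are the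
  -- same power.
  set s : ℝ := ((T : ℝ) + 1) ^ (1 - (1 - e) / 2 - 1 / 4) with hs
  have hs0 : 0 < s := by positivity
  have hterm : ∀ t : ℕ, projGap X L (τ 0) (x t) (y t) ≤
      Γ * (s * (((t : ℝ) + 1) ^ (1 / 4 : ℝ) * (‖x (t + 1) - x t‖ ^ 2 / (2 * τ t))) +
        s⁻¹ * c⁻¹ * ((t : ℝ) + 1) ^ (e - 1 / 4)) := by
    intro t
    have hx1 : x (t + 1) = PO X (x t - τ t • gradX L (x t) (y t)) := by
      obtain ⟨-, -, u, hu⟩ := hR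
      exact (hu t).1
    have ht : (0 : ℝ) < (t : ℝ) + 1 := by positivity
    have h1 := norm_PO_step_div_le hA.compactX hA.convexX (g := gradX L (x t) (y t)) (hmem t).1
      (hτ 0) (hτ t)
    rw [← hx1] at h1
    have h2 : projGap X L (τ 0) (x t) (y t) =
        ‖PO X (x t - τ 0 • gradX L (x t) (y t)) - x t‖ / τ 0 := by
      rw [projGap, norm_smul, Real.norm_of_nonneg (by have := hτ 0; positivity)]
      ring
    rw [h2]
    set N := ‖x (t + 1) - x t‖
    set w := ((t : ℝ) + 1) ^ (1 / 4 : ℝ) with hw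
    have hw0 : 0 < w := by positivity
    have hτt := hτ t
    have h3 : N / τ t ≤ s * (w * (N ^ 2 / (2 * τ t))) + (s * w * τ t)⁻¹ := by
      have h4 : 0 ≤ (s * w * N - 1) ^ 2 / (2 * (s * w * τ t)) := by positivity
      have h5 : (s * w * N - 1) ^ 2 / (2 * (s * w * τ t)) =
          s * (w * (N ^ 2 / (2 * τ t))) + (s * w * τ t)⁻¹ / 2 - N / τ t := by
        field_simp
        ring
      have h6 : 0 ≤ (s * w * τ t)⁻¹ := by positivity
      linarith
    have h7 : (s * w * τ t)⁻¹ ≤ s⁻¹ * c⁻¹ * ((t : ℝ) + 1) ^ (e - 1 / 4) := by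
      have h8 : s⁻¹ * c⁻¹ * ((t : ℝ) + 1) ^ (e - 1 / 4) =
          (s * w * (c * ((t : ℝ) + 1) ^ (-e)))⁻¹ := by
        rw [Real.rpow_sub ht, ← hw, Real.rpow_neg ht.le]
        field_simp
      rw [h8]
      gcongr
      exact hτl t
    refine h1.trans (mul_le_mul ?_ (h3.trans (by gcongr)) (by positivity) hΓ0.le)
    exact max_le_max le_rfl (by have := hτ 0; gcongr; exact hτC t)
  calc ∑ t ∈ Finset.range (T + 1), projGap X L (τ 0) (x t) (y t)
      ≤ ∑ t ∈ Finset.range (T + 1),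
        Γ * (s * (((t : ℝ) + 1) ^ (1 / 4 : ℝ) * (‖x (t + 1) - x t‖ ^ 2 / (2 * τ t))) +
        s⁻¹ * c⁻¹ * ((t : ℝ) + 1) ^ (e - 1 / 4)) := Finset.sum_le_sum fun t _ => hterm t
    _ ≤ Γ * (s * (K * ((T : ℝ) + 1) ^ (1 / 4 : ℝ)) +
          s⁻¹ * c⁻¹ * ((T : ℝ) + 1) ^ (1 + (e - 1 / 4))) := by
        rw [← Finset.mul_sum, Finset.sum_add_distrib, ← Finset.mul_sum, ← Finset.mul_sum]
        gcongr
        · exact hsum x y hR T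
        · exact sum_rpow_le (by linarith) T
    _ = Γ * (K + c⁻¹) * ((T : ℝ) + 1) ^ (1 - (1 - e) / 2) := by
        have h1 : s * ((T : ℝ) + 1) ^ (1 / 4 : ℝ) = ((T : ℝ) + 1) ^ (1 - (1 - e) / 2) := by
          rw [hs, ← Real.rpow_add hn]; congr 1; ring
        have h2 : s⁻¹ * ((T : ℝ) + 1) ^ (1 + (e - 1 / 4)) = ((T : ℝ) + 1) ^ (1 - (1 - e) / 2) := by
          rw [hs, ← Real.rpow_neg hn.le, ← Real.rpow_add hn]; congr 1; ring
        calc _ = Γ * (K * (s * ((T : ℝ) + 1) ^ (1 / 4 : ℝ)) +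
              c⁻¹ * (s⁻¹ * ((T : ℝ) + 1) ^ (1 + (e - 1 / 4)))) := by ring
          _ = _ := by rw [h1, h2]; ring

/-- From the sum of the smoothed dual gaps to the average dual gap. -/
theorem StandingAssumption.avgDualGap_rate (hA : StandingAssumption X Y L μ Lxx Lyx Lyy)
    {τ β m : ℕ → ℝ} {K C r : ℝ} (hβ : ∀ t, 0 ≤ β t) (hC : 0 ≤ C)
    (hm0 : ∀ t, 0 < m t) (hm : ∀ t, m t ≤ μ + β t) (hK : 0 ≤ K) (hr0 : 0 ≤ r) (hr1 : r < 1)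
    (hβu : ∀ t : ℕ, β t ≤ C * ((t : ℝ) + 1) ^ (-r))
    (hsum : ∀ x y, IsPOLMOSequence X Y L Lyy τ β x y → ∀ T : ℕ,
      ∑ t ∈ Finset.range (T + 1), smoothedGap Y L β x y t ≤ K * ((T : ℝ) + 1) ^ (1 - r)) :
    HasRate (IsPOLMOSequence X Y L Lyy τ β) (avgDualGap Y L) r := by
  obtain ⟨-, D, -, hD0, -, -, hD, -⟩ := hA.exists_bounds
  have h1r : 0 < 1 - r := by linarith
  refine ⟨K + D ^ 2 * (C * (1 - r)⁻¹), fun x y hR T hT => ?_⟩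
  refine runAvg_le (by positivity) hr0 hT ?_
  have hmem := fun t => hR.mem hA hβ hm0 hm t
  have hDy : ∀ w ∈ Y, ‖w - y 0‖ ≤ D := fun w hw => hD w hw _ (hmem 0).2
  have hs := sum_rpow_neg_le hr0 hr1 (T + 1)
  push_cast at hs
  calc ∑ t ∈ Finset.range (T + 1), dualGap Y L (x t) (y t)
      ≤ ∑ t ∈ Finset.range (T + 1),
          (smoothedGap Y L β x y t + D ^ 2 * (C * ((t : ℝ) + 1) ^ (-r))) := by
        refine Finset.sum_le_sum fun t _ => ?_
        refine (hA.dualGap_le_dualGap_regPayoff (hβ t) hDy (hmem t).1 (hmem t).2).trans ?_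
        unfold smoothedGap
        gcongr
        exact hβu t
    _ ≤ K * ((T : ℝ) + 1) ^ (1 - r) + D ^ 2 * (C * ((1 - r)⁻¹ * ((T : ℝ) + 1) ^ (1 - r))) := by
        rw [Finset.sum_add_distrib, ← Finset.mul_sum, ← Finset.mul_sum]
        gcongr
        exact hsum x y hR T
    _ = _ := by ring

end POLMO

/-! ### Rates for general and strongly convex dual sets -/

namespace POLMO

variable {nx ny : ℕ} {X : Set (Euc nx)} {Y : Set (Euc ny)} {L : Euc nx → Euc ny → ℝ}
  {μ Lxx Lyx Lyy : ℝ}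

theorem StandingAssumption.exists_progress (hA : StandingAssumption X Y L μ Lxx Lyx Lyy)
    {τ β m : ℕ → ℝ} (hβ : ∀ t, 0 ≤ β t) (hβa : Antitone β) (hm0 : ∀ t, 0 < m t)
    (hm : ∀ t, m t ≤ μ + β t) :
    ∃ c : ℝ, 0 < c ∧ ∀ x y, IsPOLMOSequence X Y L Lyy τ β x y → ∀ t,
      regPayoff L (y 0) (β t) (x t) (y t) + c * smoothedGap Y L β x y t ^ 2 ≤
        regPayoff L (y 0) (β t) (x t) (y (t + 1)) := by
  obtain ⟨-, D, B, hD0, hB0, -, hD, hB⟩ := hA.exists_bounds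
  set H := 2 * B + D ^ 2 * β 0 with hH
  have hβ0 := hβ 0
  have hLyy := hA.Lyy_nonneg
  have hH0 : 0 ≤ H := by positivity
  set Q := H + (Lyy + β 0) * D ^ 2 + 1 with hQ
  have hQ0 : 0 < Q := by positivity
  refine ⟨1 / (2 * Q), by positivity, fun x y hR t => ?_⟩
  have hmem := fun t => hR.mem hA hβ hm0 hm t
  have hDy : ∀ w ∈ Y, ‖w - y 0‖ ≤ D := fun w hw => hD w hw _ (hmem 0).2
  obtain ⟨-, -, u, hu⟩ := hR
  obtain ⟨-, h2, h3⟩ := hu t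
  obtain ⟨v, hv, hmax, hS⟩ := hA.exists_maximizer (y 0) (β t) ⟨_, (hmem t).2⟩ (hmem t).1
  have hgap : smoothedGap Y L β x y t = regPayoff L (y 0) (β t) (x t) v -
      regPayoff L (y 0) (β t) (x t) (y t) := by rw [smoothedGap, dualGap, ← hS]
  have hβt : β t ≤ β 0 := hβa (Nat.zero_le t)
  have hle := hA.dualGap_regPayoff_le (hβ t) hDy hB (hmem t).1 (hmem t).2
  rw [hgap]
  refine frankWolfe_progress_sq (hm0 t) (hA.strongConcaveOn_regPayoff (y 0) (hm t) (hmem t).1)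
      (fun z hz => (hA.hasGradientAt_regPayoff (y 0) (β t) (hmem t).1 hz).1)
      (fun z hz z' hz' => hA.lipschitz_gradY_regPayoff (y 0) (hβ t) (hmem t).1 hz hz')
      (add_nonneg hA.Lyy_nonneg (hβ t)) (hmem t).2 h2.1 h2.inner_le h3 hv hmax
      (by positivity) (H := H) (D := D) ?_ (hD _ h2.1 _ (hmem t).2) ?_ ?_
  · rw [← hgap]
    refine hle.trans ?_
    rw [hH]
    gcongr
  · rw [div_mul_eq_mul_div, div_le_div_iff₀ (by positivity) (by norm_num)]
    have : 0 ≤ (Lyy + β 0) * D ^ 2 := by positivity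
    linarith
  · have h5 : (Lyy + β t) * D ^ 2 ≤ (Lyy + β 0) * D ^ 2 := by gcongr
    have h6 : 2 * (1 / (2 * Q)) * (Lyy + β t) * D ^ 2 = (Lyy + β t) * D ^ 2 / Q := by
      field_simp
    rw [h6, div_le_one hQ0]
    linarith

theorem StandingAssumption.exists_progress_stronglyConvex
    (hA : StandingAssumption X Y L μ Lxx Lyx Lyy) {α : ℝ} (hα : 0 < α)
    (hY : IsStronglyConvexSet α Y) {τ β m : ℕ → ℝ} (hβ : ∀ t, 0 ≤ β t) (hβa : Antitone β)
    (hm0 : ∀ t, 0 < m t) (hm : ∀ t, m t ≤ μ + β t) :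
    ∃ c : ℝ, 0 < c ∧ ∀ x y, IsPOLMOSequence X Y L Lyy τ β x y → ∀ t,
      regPayoff L (y 0) (β t) (x t) (y t) +
          c * smoothedGap Y L β x y t * √(m t * smoothedGap Y L β x y t) ≤
        regPayoff L (y 0) (β t) (x t) (y (t + 1)) := by
  obtain ⟨-, D, B, hD0, hB0, -, hD, hB⟩ := hA.exists_bounds
  set H := 2 * B + D ^ 2 * β 0 with hH
  have hβ0 := hβ 0
  have hLyy := hA.Lyy_nonneg
  have hH0 : 0 ≤ H := by positivity
  set Q := √((μ + β 0) * H) + 16 * (Lyy + β 0) / α + 1 with hQ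
  have hQ0 : 0 < Q := by positivity
  refine ⟨1 / (2 * Q), by positivity, fun x y hR t => ?_⟩
  have hmem := fun t => hR.mem hA hβ hm0 hm t
  have hDy : ∀ w ∈ Y, ‖w - y 0‖ ≤ D := fun w hw => hD w hw _ (hmem 0).2
  obtain ⟨-, -, u, hu⟩ := hR
  obtain ⟨-, h2, h3⟩ := hu t
  obtain ⟨v, hv, hmax, hS⟩ := hA.exists_maximizer (y 0) (β t) ⟨_, (hmem t).2⟩ (hmem t).1
  have hgap : smoothedGap Y L β x y t = regPayoff L (y 0) (β t) (x t) v -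
      regPayoff L (y 0) (β t) (x t) (y t) := by rw [smoothedGap, dualGap, ← hS]
  have hβt : β t ≤ β 0 := hβa (Nat.zero_le t)
  have hle := hA.dualGap_regPayoff_le (hβ t) hDy hB (hmem t).1 (hmem t).2
  have hr : 0 ≤ √((μ + β 0) * H) := Real.sqrt_nonneg _
  rw [hgap]
  refine frankWolfe_progress_stronglyConvex hY (hm0 t)
      (hA.strongConcaveOn_regPayoff (y 0) (hm t) (hmem t).1)
      (fun z hz => (hA.hasGradientAt_regPayoff (y 0) (β t) (hmem t).1 hz).1)
      (fun z hz z' hz' => hA.lipschitz_gradY_regPayoff (y 0) (hβ t) (hmem t).1 hz hz')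
      (add_nonneg hA.Lyy_nonneg (hβ t)) (hmem t).2 h2.1 h2.inner_le h3 hv hmax
      (by positivity) (H := H) ?_ ?_ ?_
  · rw [← hgap]
    refine hle.trans ?_
    rw [hH]
    gcongr
  · have h5 : √(m t * H) ≤ √((μ + β 0) * H) := by
      gcongr
      exact (hm t).trans (by gcongr)
    rw [div_mul_eq_mul_div, div_le_div_iff₀ (by positivity) (by norm_num)]
    have : 0 ≤ 16 * (Lyy + β 0) / α := by positivity
    linarith
  · have h5 : 16 * (Lyy + β t) / α ≤ 16 * (Lyy + β 0) / α := by gcongr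
    have h6 : 16 * (Lyy + β t) / α ≤ 2 * Q := by linarith
    rw [div_le_iff₀ hα] at h6
    have h7 : 16 * (1 / (2 * Q)) * (Lyy + β t) = 16 * (Lyy + β t) / (2 * Q) := by ring
    rw [h7, div_le_iff₀ (by positivity)]
    linarith

theorem young_sq {c q h : ℝ} (hc : 0 < c) : q * h ≤ c * h ^ 2 + q ^ 2 / c := by
  have h1 : c * h ^ 2 + q ^ 2 / c - q * h =
      ((2 * c * h - q) ^ 2 + 3 * q ^ 2) / (4 * c) := by field_simp; ring
  have h2 : 0 ≤ ((2 * c * h - q) ^ 2 + 3 * q ^ 2) / (4 * c) := by positivity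
  linarith

/-- Either `q` is below `c √(m h)` and the first term suffices, or `h ≤ q² / (c² m)` and the second
does. -/
theorem young_mul_sqrt {c q m h : ℝ} (hc : 0 < c) (hq : 0 ≤ q) (hm : 0 < m) (hh : 0 ≤ h) :
    q * h ≤ c * h * √(m * h) + q ^ 3 / (c ^ 2 * m) := by
  rcases le_total q (c * √(m * h)) with h1 | h1
  · have h2 : q * h ≤ c * √(m * h) * h := by gcongr
    have h3 : 0 ≤ q ^ 3 / (c ^ 2 * m) := by positivity
    linarith
  · have h2 : (c * √(m * h)) ^ 2 ≤ q ^ 2 := by gcongr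
    rw [mul_pow, Real.sq_sqrt (by positivity)] at h2
    have h3 : h ≤ q ^ 2 / (c ^ 2 * m) := by
      rw [le_div_iff₀ (by positivity)]; linarith
    have h4 : q * h ≤ q * (q ^ 2 / (c ^ 2 * m)) := by gcongr
    have h5 : q * (q ^ 2 / (c ^ 2 * m)) = q ^ 3 / (c ^ 2 * m) := by ring
    have h6 : 0 ≤ c * h * √(m * h) := by positivity
    linarith

theorem StandingAssumption.sum_rates (hA : StandingAssumption X Y L μ Lxx Lyx Lyy)
    {τ β m : ℕ → ℝ} {cτ Cτ cm e b : ℝ} (hcτ : 0 < cτ) (hcm : 0 < cm) (hτ : ∀ t, 0 < τ t)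
    (he0 : 1 / 4 ≤ e) (he1 : e ≤ 1) (heb : 1 ≤ 2 * e - 2 * b)
    (hτl : ∀ t : ℕ, cτ * ((t : ℝ) + 1) ^ (-e) ≤ τ t)
    (hτu : ∀ t : ℕ, τ t ≤ Cτ * ((t : ℝ) + 1) ^ (-e)) (hβ : ∀ t, 0 ≤ β t) (hβa : Antitone β)
    (hml : ∀ t : ℕ, cm * ((t : ℝ) + 1) ^ (-b) ≤ m t) (hm : ∀ t, m t ≤ μ + β t) :
    HasRate (IsPOLMOSequence X Y L Lyy τ β) (avgProjGap X L (τ 0)) ((1 - e) / 2) ∧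
    ∃ K : ℝ, 0 ≤ K ∧ ∀ x y, IsPOLMOSequence X Y L Lyy τ β x y → ∀ T : ℕ,
      ∑ t ∈ Finset.range (T + 1), smoothedGap Y L β x y t ≤ K * ((T : ℝ) + 1) ^ (1 / 2 : ℝ) := by
  have hm0 : ∀ t, 0 < m t := fun t => lt_of_lt_of_le (by positivity) (hml t)
  obtain ⟨c, hc, hprog⟩ := hA.exists_progress (τ := τ) hβ hβa hm0 hm
  obtain ⟨K, hK, hsum⟩ := hA.sum_progress_le (P := fun _ h => c * h ^ 2)
    (m₀ := μ + β 0) (K₁ := (8 * Lyx ^ 2) ^ 2 / (c / 2) * (Cτ ^ 2 / cm ^ 2)) (K₂ := Cτ ^ 3 / cm ^ 2)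
    hτ hβ hβa hm0 hm (fun t => (hm t).trans (by gcongr; exact hβa (Nat.zero_le t)))
    (fun t h _ => by positivity) hprog
    (fun t h hh => by
      have h1 := young_sq (c := c / 2) (q := 8 * Lyx ^ 2 * (τ t / m t)) (h := h) (by positivity)
      have h2 := pow_div_pow_le_div hcm hτ hτu hml (i := 2) (j := 2) (by push_cast; linarith) t
      calc 8 * Lyx ^ 2 * (τ t * h / m t) = 8 * Lyx ^ 2 * (τ t / m t) * h := by ring
        _ ≤ c / 2 * h ^ 2 + (8 * Lyx ^ 2) ^ 2 / (c / 2) * (τ t ^ 2 / m t ^ 2) := by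
            refine h1.trans (le_of_eq ?_); ring
        _ ≤ c / 2 * h ^ 2 + (8 * Lyx ^ 2) ^ 2 / (c / 2) * (Cτ ^ 2 / cm ^ 2 / ((t : ℝ) + 1)) := by
            gcongr
        _ = _ := by ring)
    (fun t => pow_div_pow_le_div hcm hτ hτu hml (by push_cast; linarith) t)
  have hmem := fun x y (hR : IsPOLMOSequence X Y L Lyy τ β x y) t => hR.mem hA hβ hm0 hm t
  refine ⟨hA.avgProjGap_rate (m := m) hcτ hτ he0 he1 hτl hτu hβ hm0 hm hK fun x y hR T =>
    (Finset.sum_le_sum fun t _ => ?_).trans (hsum x y hR T), 2 * K / c + 4 / 3, by positivity,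
    fun x y hR T => ?_⟩
  · gcongr
    exact le_add_of_nonneg_left (by positivity)
  have hn : (0 : ℝ) < (T : ℝ) + 1 := by positivity
  -- This balances `s² = (T + 1)^(1/2)` against `s⁻¹ (T + 1)^(3/4)`.
  set s : ℝ := ((T : ℝ) + 1) ^ (1 / 4 : ℝ) with hs
  have hs0 : 0 < s := by positivity
  have hS := sum_rpow_neg_le (s := 1 / 4) (by norm_num) (by norm_num) (T + 1)
  norm_num at hS
  have hsum' := hsum x y hR T
  calc ∑ t ∈ Finset.range (T + 1), smoothedGap Y L β x y t
      ≤ ∑ t ∈ Finset.range (T + 1), (2 / c * s * (((t : ℝ) + 1) ^ (1 / 4 : ℝ) *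
          (c * smoothedGap Y L β x y t ^ 2 / 2 + ‖x (t + 1) - x t‖ ^ 2 / (2 * τ t))) +
          s⁻¹ * ((t : ℝ) + 1) ^ (-(1 / 4) : ℝ)) := by
        refine Finset.sum_le_sum fun t _ => ?_
        have ht : (0 : ℝ) < (t : ℝ) + 1 := by positivity
        set w := ((t : ℝ) + 1) ^ (1 / 4 : ℝ) with hw
        have hw0 : 0 < w := by positivity
        have h1 := young_sq (c := s * w) (q := 1) (h := smoothedGap Y L β x y t) (by positivity)
        have h2 : 0 ≤ 2 / c * s * (w * (‖x (t + 1) - x t‖ ^ 2 / (2 * τ t))) := by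
          have := hτ t
          positivity
        rw [Real.rpow_neg ht.le, ← hw]
        have h3 : 2 / c * s * (w * (c * smoothedGap Y L β x y t ^ 2 / 2 +
            ‖x (t + 1) - x t‖ ^ 2 / (2 * τ t))) = s * w * smoothedGap Y L β x y t ^ 2 +
            2 / c * s * (w * (‖x (t + 1) - x t‖ ^ 2 / (2 * τ t))) := by
          field_simp
        have h4 : 1 ^ 2 / (s * w) = s⁻¹ * w⁻¹ := by field_simp
        linarith
    _ ≤ 2 / c * s * (K * s) + s⁻¹ * (4 / 3 * ((T : ℝ) + 1) ^ (3 / 4 : ℝ)) := by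
        rw [Finset.sum_add_distrib, ← Finset.mul_sum, ← Finset.mul_sum]
        gcongr
    _ = _ := by
        have h1 : s * s = ((T : ℝ) + 1) ^ (1 / 2 : ℝ) := by
          rw [hs, ← Real.rpow_add hn]; norm_num
        have h2 : s⁻¹ * ((T : ℝ) + 1) ^ (3 / 4 : ℝ) = ((T : ℝ) + 1) ^ (1 / 2 : ℝ) := by
          rw [hs, ← Real.rpow_neg hn.le, ← Real.rpow_add hn]; norm_num
        calc _ = 2 * K / c * (s * s) + 4 / 3 * (s⁻¹ * ((T : ℝ) + 1) ^ (3 / 4 : ℝ)) := by ring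
          _ = _ := by rw [h1, h2]; ring

theorem StandingAssumption.sum_rates_stronglyConvex
    (hA : StandingAssumption X Y L μ Lxx Lyx Lyy) {α : ℝ} (hα : 0 < α)
    (hY : IsStronglyConvexSet α Y)
    {τ β m : ℕ → ℝ} {cτ Cτ cm e b : ℝ} (hcτ : 0 < cτ) (hcm : 0 < cm) (hτ : ∀ t, 0 < τ t)
    (he0 : 1 / 4 ≤ e) (he1 : e ≤ 1) (hb0 : 0 ≤ b) (hb1 : b ≤ 1 / 2) (heb : 1 ≤ 3 * e - 4 * b)
    (hτl : ∀ t : ℕ, cτ * ((t : ℝ) + 1) ^ (-e) ≤ τ t)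
    (hτu : ∀ t : ℕ, τ t ≤ Cτ * ((t : ℝ) + 1) ^ (-e)) (hβ : ∀ t, 0 ≤ β t) (hβa : Antitone β)
    (hml : ∀ t : ℕ, cm * ((t : ℝ) + 1) ^ (-b) ≤ m t) (hm : ∀ t, m t ≤ μ + β t) :
    HasRate (IsPOLMOSequence X Y L Lyy τ β) (avgProjGap X L (τ 0)) ((1 - e) / 2) ∧
    ∃ K : ℝ, 0 ≤ K ∧ ∀ x y, IsPOLMOSequence X Y L Lyy τ β x y → ∀ T : ℕ,
      ∑ t ∈ Finset.range (T + 1), smoothedGap Y L β x y t ≤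
        K * ((T : ℝ) + 1) ^ (1 / 3 + b / 3) := by
  have hm0 : ∀ t, 0 < m t := fun t => lt_of_lt_of_le (by positivity) (hml t)
  obtain ⟨c, hc, hprog⟩ := hA.exists_progress_stronglyConvex hα hY (τ := τ) hβ hβa hm0 hm
  obtain ⟨K, hK, hsum⟩ := hA.sum_progress_le (P := fun t h => c * h * √(m t * h))
    (m₀ := μ + β 0) (K₁ := (8 * Lyx ^ 2) ^ 3 / (c / 2) ^ 2 * (Cτ ^ 3 / cm ^ 4))
    (K₂ := Cτ ^ 3 / cm ^ 2)
    hτ hβ hβa hm0 hm (fun t => (hm t).trans (by gcongr; exact hβa (Nat.zero_le t)))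
    (fun t h _ => by positivity) hprog
    (fun t h hh => by
      have hmt := hm0 t
      have hτt := hτ t
      have h1 := young_mul_sqrt (c := c / 2) (q := 8 * Lyx ^ 2 * (τ t / m t)) (h := h) (m := m t)
        (by positivity) (by positivity) hmt hh
      have h2 := pow_div_pow_le_div hcm hτ hτu hml (i := 3) (j := 4) (by push_cast; linarith) t
      calc 8 * Lyx ^ 2 * (τ t * h / m t) = 8 * Lyx ^ 2 * (τ t / m t) * h := by ring
        _ ≤ c * h * √(m t * h) / 2 +
            (8 * Lyx ^ 2) ^ 3 / (c / 2) ^ 2 * (τ t ^ 3 / m t ^ 4) := by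
            refine h1.trans (le_of_eq ?_); field_simp
        _ ≤ c * h * √(m t * h) / 2 +
            (8 * Lyx ^ 2) ^ 3 / (c / 2) ^ 2 * (Cτ ^ 3 / cm ^ 4 / ((t : ℝ) + 1)) := by
            gcongr
        _ = _ := by ring)
    (fun t => pow_div_pow_le_div hcm hτ hτu hml (by push_cast; linarith) t)
  have hh0 : ∀ x y, IsPOLMOSequence X Y L Lyy τ β x y → ∀ t, 0 ≤ smoothedGap Y L β x y t :=
    fun x y hR t => hA.dualGap_nonneg (y 0) (β t) (hR.mem hA hβ hm0 hm t).1
      (hR.mem hA hβ hm0 hm t).2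
  have hbs : 0 < 1 / 2 + b := by linarith
  refine ⟨hA.avgProjGap_rate (m := m) hcτ hτ he0 he1 hτl hτu hβ hm0 hm hK fun x y hR T =>
    (Finset.sum_le_sum fun t _ => ?_).trans (hsum x y hR T), 2 * K / c + cm⁻¹ * (1 / 2 + b)⁻¹,
    by positivity, fun x y hR T => ?_⟩
  · have := hh0 x y hR t
    gcongr
    exact le_add_of_nonneg_left (by positivity)
  have hn : (0 : ℝ) < (T : ℝ) + 1 := by positivity
  -- This balances `s (T + 1)^(1/4)` against `s⁻² (T + 1)^(1/2 + b)`; the latter comes from summing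
  -- `1 / (w² m_t)`.
  set s : ℝ := ((T : ℝ) + 1) ^ (1 / 12 + b / 3) with hs
  have hs0 : 0 < s := by positivity
  have hS := sum_rpow_neg_le (s := 1 / 2 - b) (by linarith) (by linarith) (T + 1)
  rw [show 1 - (1 / 2 - b) = 1 / 2 + b by ring] at hS
  push_cast at hS
  have hsum' := hsum x y hR T
  calc ∑ t ∈ Finset.range (T + 1), smoothedGap Y L β x y t
      ≤ ∑ t ∈ Finset.range (T + 1), (2 / c * s * (((t : ℝ) + 1) ^ (1 / 4 : ℝ) *
          (c * smoothedGap Y L β x y t * √(m t * smoothedGap Y L β x y t) / 2 +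
            ‖x (t + 1) - x t‖ ^ 2 / (2 * τ t))) +
          (s ^ 2)⁻¹ * (cm⁻¹ * ((t : ℝ) + 1) ^ (-(1 / 2 - b)))) := by
        refine Finset.sum_le_sum fun t _ => ?_
        have ht : (0 : ℝ) < (t : ℝ) + 1 := by positivity
        have hmt := hm0 t
        have hτt := hτ t
        set w := ((t : ℝ) + 1) ^ (1 / 4 : ℝ) with hw
        have hw0 : 0 < w := by positivity
        have h1 := young_mul_sqrt (c := s * w) (q := 1) (m := m t) (by positivity) zero_le_one hmt
          (hh0 x y hR t)
        have h2 : 0 ≤ 2 / c * s * (w * (‖x (t + 1) - x t‖ ^ 2 / (2 * τ t))) := by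
          positivity
        have h3 : 2 / c * s * (w * (c * smoothedGap Y L β x y t *
            √(m t * smoothedGap Y L β x y t) / 2 + ‖x (t + 1) - x t‖ ^ 2 / (2 * τ t))) =
            s * w * smoothedGap Y L β x y t * √(m t * smoothedGap Y L β x y t) +
            2 / c * s * (w * (‖x (t + 1) - x t‖ ^ 2 / (2 * τ t))) := by
          field_simp
        have h4 : 1 ^ 3 / ((s * w) ^ 2 * m t) ≤
            (s ^ 2)⁻¹ * (cm⁻¹ * ((t : ℝ) + 1) ^ (-(1 / 2 - b))) := by
          have h5 : w ^ 2 = ((t : ℝ) + 1) ^ (1 / 2 : ℝ) := by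
            rw [hw, ← Real.rpow_mul_natCast ht.le]; norm_num
          have h6 : (s ^ 2)⁻¹ * (cm⁻¹ * ((t : ℝ) + 1) ^ (-(1 / 2 - b))) =
              1 / ((s * w) ^ 2 * (cm * ((t : ℝ) + 1) ^ (-b))) := by
            rw [mul_pow, h5, show -(1 / 2 - b) = -((1 / 2) + (-b)) by ring, Real.rpow_neg ht.le,
              Real.rpow_add ht]
            field_simp
          rw [h6, one_pow]
          gcongr
          exact hml t
        linarith
    _ ≤ 2 / c * s * (K * ((T : ℝ) + 1) ^ (1 / 4 : ℝ)) +
          (s ^ 2)⁻¹ * (cm⁻¹ * ((1 / 2 + b)⁻¹ * ((T : ℝ) + 1) ^ (1 / 2 + b))) := by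
        rw [Finset.sum_add_distrib, ← Finset.mul_sum, ← Finset.mul_sum, ← Finset.mul_sum]
        gcongr
    _ = _ := by
        have h1 : s * ((T : ℝ) + 1) ^ (1 / 4 : ℝ) = ((T : ℝ) + 1) ^ (1 / 3 + b / 3) := by
          rw [hs, ← Real.rpow_add hn]; congr 1; ring
        have h2 : (s ^ 2)⁻¹ * ((T : ℝ) + 1) ^ (1 / 2 + b) = ((T : ℝ) + 1) ^ (1 / 3 + b / 3) := by
          rw [hs, ← Real.rpow_mul_natCast hn.le, ← Real.rpow_neg hn.le, ← Real.rpow_add hn]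
          congr 1; push_cast; ring
        calc _ = 2 * K / c * (s * ((T : ℝ) + 1) ^ (1 / 4 : ℝ)) +
              cm⁻¹ * (1 / 2 + b)⁻¹ * ((s ^ 2)⁻¹ * ((T : ℝ) + 1) ^ (1 / 2 + b)) := by ring
          _ = _ := by rw [h1, h2]; ring

theorem sum_le_rpow_of_exponent_le {g : ℕ → ℝ} {K r s : ℝ} (hK : 0 ≤ K) (hrs : r ≤ s) {T : ℕ}
    (h : ∑ t ∈ Finset.range (T + 1), g t ≤ K * ((T : ℝ) + 1) ^ r) :
    ∑ t ∈ Finset.range (T + 1), g t ≤ K * ((T : ℝ) + 1) ^ s :=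
  h.trans (mul_le_mul_of_nonneg_left (Real.rpow_le_rpow_of_exponent_le
    (by linarith [(Nat.cast_nonneg T : (0 : ℝ) ≤ T)]) hrs) hK)

end POLMO

theorem theorem5 {nx ny : ℕ} (X : Set (POLMO.Euc nx)) (Y : Set (POLMO.Euc ny))
    (L : POLMO.Euc nx → POLMO.Euc ny → ℝ) (μ Lxx Lyx Lyy : ℝ)
    (hA : POLMO.StandingAssumption X Y L μ Lxx Lyx Lyy) :
    -- nonconvex-concave
    (∀ τ β : ℕ → ℝ, POLMO.IsStepsize (2 / 3) τ → POLMO.IsSmoothing (1 / 6) β →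
      POLMO.HasRateLog (POLMO.IsPOLMOSequence X Y L Lyy τ β)
        (POLMO.avgProjGap X L (τ 0)) (1 / 6) ∧
      POLMO.HasRateLog (POLMO.IsPOLMOSequence X Y L Lyy τ β)
        (POLMO.avgDualGap Y L) (1 / 6)) ∧
    -- nonconvex-strongly concave
    (0 < μ → ∀ τ : ℕ → ℝ, POLMO.IsStepsize (1 / 2) τ →
      POLMO.HasRate (POLMO.IsPOLMOSequence X Y L Lyy τ (fun _ => 0))
        (POLMO.avgProjGap X L (τ 0)) (1 / 4) ∧
      POLMO.HasRateLog (POLMO.IsPOLMOSequence X Y L Lyy τ (fun _ => 0))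
        (POLMO.avgDualGap Y L) (1 / 2)) ∧
    -- nonconvex-concave with a strongly convex dual set
    (∀ α : ℝ, 0 < α → POLMO.IsStronglyConvexSet α Y →
      ∀ τ β : ℕ → ℝ, POLMO.IsStepsize (3 / 5) τ → POLMO.IsSmoothing (1 / 5) β →
      POLMO.HasRate (POLMO.IsPOLMOSequence X Y L Lyy τ β)
        (POLMO.avgProjGap X L (τ 0)) (1 / 5) ∧
      POLMO.HasRate (POLMO.IsPOLMOSequence X Y L Lyy τ β)
        (POLMO.avgDualGap Y L) (1 / 5)) ∧
    -- nonconvex-strongly concave with a strongly convex dual set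
    (0 < μ → ∀ α : ℝ, 0 < α → POLMO.IsStronglyConvexSet α Y →
      ∀ τ : ℕ → ℝ, POLMO.IsStepsize (1 / 3) τ →
      POLMO.HasRate (POLMO.IsPOLMOSequence X Y L Lyy τ (fun _ => 0))
        (POLMO.avgProjGap X L (τ 0)) (1 / 3) ∧
      POLMO.HasRateLog (POLMO.IsPOLMOSequence X Y L Lyy τ (fun _ => 0))
        (POLMO.avgDualGap Y L) (2 / 3)) := by
  refine ⟨fun τ β hτ hβ => ?_, fun hμ τ hτ => ?_, fun α hα hY τ β hτ hβ => ?_,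
    fun hμ α hα hY τ hτ => ?_⟩
  · obtain ⟨cτ, Cτ, hcτ, -, hτb⟩ := POLMO.exists_rpow_bounds (by norm_num) hτ.1 hτ.2
    obtain ⟨cβ, Cβ, hcβ, hCβ, hβb⟩ := POLMO.exists_rpow_bounds (by norm_num) hβ.pos hβ.2.2
    -- The modulus is `m_t = β_t`, and `2 · 2/3 - 2 · 1/6 = 1` meets the exponent condition with
    -- equality.
    have hm : ∀ t, β t ≤ μ + β t := fun t => le_add_of_nonneg_left hA.mu_nonneg
    obtain ⟨h1, K, hK, h2⟩ := hA.sum_rates hcτ hcβ hτ.1 (by norm_num) (by norm_num) (by norm_num)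
      (fun t => (hτb t).1) (fun t => (hτb t).2) hβ.1 hβ.2.1 (fun t => (hβb t).1) hm
    norm_num at h1
    refine ⟨h1.hasRateLog, (hA.avgDualGap_rate (r := 1 / 6) hβ.1 hCβ.le hβ.pos hm hK (by norm_num)
      (by norm_num) (fun t => (hβb t).2) fun x y hR T => ?_).hasRateLog⟩
    -- The smoothed gaps sum to `O(T^(1/2))`, well below the `T^(5/6)` required; the rate `1/6` is
    -- due to the bias `D² β_t`.
    exact POLMO.sum_le_rpow_of_exponent_le hK (by norm_num) (h2 x y hR T)
  · obtain ⟨cτ, Cτ, hcτ, -, hτb⟩ := POLMO.exists_rpow_bounds (by norm_num) hτ.1 hτ.2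
    obtain ⟨h1, K, hK, h2⟩ := hA.sum_rates (β := fun _ => 0) (m := fun _ => μ) (b := 0) hcτ hμ hτ.1
      (by norm_num) (by norm_num) (by norm_num) (fun t => (hτb t).1) (fun t => (hτb t).2)
      (fun _ => le_rfl) antitone_const (by simp) (by simp)
    norm_num at h1
    refine ⟨h1, (hA.avgDualGap_rate (m := fun _ => μ) (r := 1 / 2) (C := 0) (fun _ => le_rfl) le_rfl
      (fun _ => hμ) (by simp) hK (by norm_num) (by norm_num) (by simp) fun x y hR T =>
      ?_).hasRateLog⟩
    exact POLMO.sum_le_rpow_of_exponent_le hK (by norm_num) (h2 x y hR T)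
  · obtain ⟨cτ, Cτ, hcτ, -, hτb⟩ := POLMO.exists_rpow_bounds (by norm_num) hτ.1 hτ.2
    obtain ⟨cβ, Cβ, hcβ, hCβ, hβb⟩ := POLMO.exists_rpow_bounds (by norm_num) hβ.pos hβ.2.2
    have hm : ∀ t, β t ≤ μ + β t := fun t => le_add_of_nonneg_left hA.mu_nonneg
    obtain ⟨h1, K, hK, h2⟩ := hA.sum_rates_stronglyConvex hα hY hcτ hcβ hτ.1 (by norm_num)
      (by norm_num) (by norm_num) (by norm_num) (by norm_num)
      (fun t => (hτb t).1) (fun t => (hτb t).2) hβ.1 hβ.2.1 (fun t => (hβb t).1) hm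
    norm_num at h1
    refine ⟨h1, hA.avgDualGap_rate (r := 1 / 5) hβ.1 hCβ.le hβ.pos hm hK (by norm_num)
      (by norm_num) (fun t => (hβb t).2) fun x y hR T => ?_⟩
    -- With `b = 1/5` the smoothed gaps sum to `O(T^(2/5))`, so again the bias, of total order
    -- `T^(4/5)`, decides.
    exact POLMO.sum_le_rpow_of_exponent_le hK (by norm_num) (h2 x y hR T)
  · obtain ⟨cτ, Cτ, hcτ, -, hτb⟩ := POLMO.exists_rpow_bounds (by norm_num) hτ.1 hτ.2
    obtain ⟨h1, K, hK, h2⟩ := hA.sum_rates_stronglyConvex hα hY (β := fun _ => 0) (m := fun _ => μ)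
      (b := 0) hcτ hμ hτ.1 (by norm_num) (by norm_num) le_rfl (by norm_num) (by norm_num)
      (fun t => (hτb t).1) (fun t => (hτb t).2) (fun _ => le_rfl) antitone_const (by simp) (by simp)
    norm_num at h1
    refine ⟨h1, (hA.avgDualGap_rate (m := fun _ => μ) (r := 2 / 3) (C := 0) (fun _ => le_rfl) le_rfl
      (fun _ => hμ) (by simp) hK (by norm_num) (by norm_num) (by simp) fun x y hR T =>
      ?_).hasRateLog⟩
    exact POLMO.sum_le_rpow_of_exponent_le hK (by norm_num) (h2 x y hR T)
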